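/- Let $k\ge 2$ be an integer and let $\alpha\in\mathbb C$ with $\alpha\ne 0$ and $|\alpha|<2$. For a bounded function $f:\mathbb R\to\mathbb C$ and an integer $N\ge 2$ put $$S_{\Omega,f}(k,\alpha;N)=\sum_{n}f\!\left(\frac{\log n}{\log N}\right)\frac{\alpha^{\Omega(n)}}{n},$$ where $n$ runs over the positive integers that are $k$-free (divisible by no $p^k$ with $p$ prime) and all of whose prime factors are $\le N$, and $\Omega(n)$ is the number of prime factors of $n$ counted with multiplicity. Let $$\varphi^{(\alpha)}(\lambda)=\exp\left(\alpha\int_0^1\frac{e^{i\lambda v}-1}{v}\,dv\right),\qquad \lambda\in\mathbb R.$$ The Fourier transform is normalized by $\hat f(\lambda)=\frac1{2\pi}\int_{\mathbb R} f(x)e^{-i\lambda x}\,dx$ (understood in the sense of tempered distributions when $f$ is not integrable). Then there is a constant $C=C(k,\alpha)\in\mathbb C$, $C\neq 0$, with the following property. Let $\eta>|\alpha|-\Re\alpha+1$, and let $f:\mathbb R\to\mathbb C$ be a bounded continuous function whose Fourier transform is a function $\hat f$ satisfying, for some constant $c>0$, $|\hat f(\lambda)|\le \frac{c}{1+|\lambda|^{\eta}}$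 for all $\lambda\in\mathbb R$. Let $R=R(N)$ be a real function of $N$, positive for all large $N$, such that, as $N\to\infty$, $$\frac{R}{\log N}\to 0\qquad\text{and}\qquad\frac{(\log N)^{|\alpha|-\Re\alpha}}{R^{\eta-1}}\to 0.$$ Then for all integers $N\ge 2$ $$S_{\Omega,f}(k,\alpha;N)=C\,(\log N)^{\alpha}\left(\int_{|\lambda|\le R}\varphi^{(\alpha)}(\lambda)\hat f(\lambda)\,d\lambda+\varepsilon_N\right),$$ where $\varepsilon_N\to0$ as $N\to\infty$ and $$\varepsilon_N=O\!\left(\frac{\log\log N}{\log N}\right)+O\!\left(\frac{(\log N)^{|\alpha|-\Re\alpha}}{R^{\eta-1}}\right).$$ The implied constants may depend on $k$, $\alpha$, $\eta$, $f$ and $R$. -/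

import Mathlib

open Filter Topology Asymptotics MeasureTheory
open scoped SchwartzMap

/-- `n` is `k`-free: no `k`-th power of a prime divides `n`. -/
def KFree (k n : ℕ) : Prop := ∀ p : ℕ, p.Prime → ¬ p ^ k ∣ n

/-- The positive integers that are `k`-free and all of whose prime factors are at most `N`. -/
def kFreeSmooth (k N : ℕ) : Set ℕ :=
  {n | 0 < n ∧ KFree k n ∧ ∀ p : ℕ, p.Prime → p ∣ n → p ≤ N}

theorem kFreeSmooth_finite (k N : ℕ) : (kFreeSmooth k N).Finite := by
  refine (Set.finite_Iic (∏ p ∈ Finset.range (N + 1), (p + 1) ^ k)).subset ?_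
  rintro n ⟨hn, hk, hp⟩
  have hsub : n.primeFactors ⊆ Finset.range (N + 1) := by
    intro p hpn
    have h := Nat.mem_primeFactors.mp hpn
    exact Finset.mem_range.mpr (Nat.lt_succ_of_le (hp p h.1 h.2.1))
  have h1 : n = ∏ p ∈ n.primeFactors, p ^ n.factorization p :=
    (Nat.prod_factorization_pow_eq_self hn.ne').symm
  show n ≤ _
  calc n = ∏ p ∈ n.primeFactors, p ^ n.factorization p := h1
    _ ≤ ∏ p ∈ n.primeFactors, (p + 1) ^ k := by
        refine Finset.prod_le_prod' fun p hpn => ?_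
        have h := Nat.mem_primeFactors.mp hpn
        have hle : n.factorization p ≤ k := by
          by_contra hlt
          exact hk p h.1 ((pow_dvd_pow p (not_le.mp hlt).le).trans (Nat.ordProj_dvd n p))
        calc p ^ n.factorization p ≤ (p + 1) ^ n.factorization p :=
              Nat.pow_le_pow_left (Nat.le_succ p) _
          _ ≤ (p + 1) ^ k := Nat.pow_le_pow_right (Nat.succ_pos p) hle
    _ ≤ ∏ p ∈ Finset.range (N + 1), (p + 1) ^ k :=
        Finset.prod_le_prod_of_subset_of_one_le' hsub
          fun p _ _ => Nat.one_le_pow _ _ (Nat.succ_pos p)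

/-- `S_{Ω,f}(k,α;N)`, the sum of `f (log n / log N) α ^ Ω(n) / n` over the `k`-free integers `n`
whose prime factors are at most `N`; here `Ω` counts prime factors with multiplicity. -/
noncomputable def smoothSum (f : ℝ → ℂ) (k : ℕ) (α : ℂ) (N : ℕ) : ℂ :=
  ∑ n ∈ (kFreeSmooth_finite k N).toFinset,
    f (Real.log n / Real.log N) * (α ^ ArithmeticFunction.cardFactors n / (n : ℂ))

/-- `φ^{(α)}(t) = exp (α ∫₀¹ (e^{i t v} - 1) / v dv)`. -/
noncomputable def phi (α : ℂ) (t : ℝ) : ℂ :=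
  Complex.exp (α * ∫ v in (0 : ℝ)..1, (Complex.exp (Complex.I * t * v) - 1) / (v : ℂ))

/-- For a bounded measurable function `f`: the function `g` is the Fourier transform of `f`,
with the normalization `g t = (2π)⁻¹ ∫ f x e^{-i t x} dx` (so that inversion reads
`f x = ∫ g t e^{i t x} dt`). The equation is meant in the sense of tempered distributions, so it
covers integrable as well as square-integrable `f`. -/
def IsFourierTransform (f g : ℝ → ℂ) : Prop :=
  AEStronglyMeasurable g volume ∧
  ∀ ψ : 𝓢(ℝ, ℂ), Integrable (fun t : ℝ => g t * ψ t) ∧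
    ∫ t : ℝ, g t * ψ t =
      ∫ x : ℝ, f x *
        ((2 * Real.pi : ℂ)⁻¹ * ∫ t : ℝ, Complex.exp (-(Complex.I * t * x)) * ψ t)

/-- The decay condition that defines the class `S_η`: a function with Fourier transform `g`
belongs to `S_η` when `|g t| ≤ C / (1 + |t| ^ η)` for all real `t`,
with some constant `C > 0`. -/
def FourierDecay (η : ℝ) (g : ℝ → ℂ) : Prop :=
  ∃ C : ℝ, 0 < C ∧ ∀ t : ℝ, ‖g t‖ ≤ C / (1 + |t| ^ η)

/-! Write `L = log N`. Fourier inversion turns the weight `f (log n / L)` into an average of the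
characters `n ^ (i t / L)`, so the sum equals `∫ fhat t * Z (t / L) dt`, where `Z` is the twisted
sum of `α ^ Ω(n) n ^ (-1 + i t)` without weight (`smoothSum_eq_integral`). The problem is then to
know `Z (l / L)` uniformly in `l`.

`Z` is a finite Euler product with local factors `1 + x + ⋯ + x ^ (k - 1)`, `x = α p ^ (-1 + i t)`.
Since `|α| < 2`, always `|x| < 1`, and each factor is `exp (x + O(|x| ^ 2))`. The quadratic parts
sum to a constant, up to a small error. The linear parts give `α` times a twisted prime sum, which
Mertens' theorems with partial summation evaluate as `log L + M` plus the exponent of `phi`. Hence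
`Z (l / L) = C L ^ α phi(l) e ^ z` with `z = O((1 + |l|) log L / L)`
(`twistedSmoothSum_asymptotic`).

For `|t| ≤ R` this formula is inserted. There `phi` has size at most a constant times `(1 + |t|) ^
(-Re α)`, so the integrand decays with exponent `Re α + η > |α| + 1`. The error `z` need not be
bounded, but `R = o(L)` forces `e ^ |z| ≤ L ^ (|α| / 4)`, and the spare decay absorbs this loss
(`rpow_neg_mul_error_le`). For `|t| > R` the bound `|Z| ≪ L ^ |α|` suffices
(`norm_twistedSmoothSum_le`): divided by `|L ^ α|` and integrated against the tail of `fhat`, it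
gives the second error term. -/

/-! ### Mertens' first theorem -/

/-- The logarithm of a factorial, summed over its prime factorization. -/
theorem log_factorial_eq_sum_primesLE (n : ℕ) :
    Real.log (n.factorial) = ∑ p ∈ n.primesLE, (n.factorial.factorization p) * Real.log p := by
  have hsub : n.factorial.primeFactors ⊆ n.primesLE := by
    intro p hp
    have h := Nat.mem_primeFactors.mp hp
    exact Nat.mem_primesLE.mpr ⟨(h.1.dvd_factorial).mp h.2.1, h.1⟩
  have h0 : (n.factorial : ℝ) = ∏ p ∈ n.primesLE, (p : ℝ) ^ n.factorial.factorization p := by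
    have h1 := Nat.prod_factorization_pow_eq_self (Nat.factorial_ne_zero n)
    rw [Finsupp.prod, Nat.support_factorization] at h1
    rw [← Finset.prod_subset hsub]
    · exact_mod_cast h1.symm
    · intro p _ hp
      rw [← Nat.support_factorization, Finsupp.notMem_support_iff] at hp
      simp [hp]
  rw [h0, Real.log_prod]
  · exact Finset.sum_congr rfl fun p _ => by rw [Real.log_pow]
  · intro p hp
    have := (Nat.mem_primesLE.mp hp).2.pos
    positivity

/-- Legendre's formula: `(p - 1) v_p(n!)` is `n` minus the base `p` digit sum of `n`. -/
theorem factorization_factorial_le {n p : ℕ} (hp : p.Prime) :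
    (n.factorial.factorization p : ℝ) ≤ n / ((p : ℝ) - 1) := by
  have := Fact.mk hp
  have h := sub_one_mul_padicValNat_factorial (p := p) n
  rw [Nat.factorization_def _ hp]
  have hp1 : (1 : ℝ) < p := by exact_mod_cast hp.one_lt
  rw [le_div_iff₀ (by linarith)]
  have h2 : (p - 1) * padicValNat p n.factorial ≤ n := by omega
  have h3 : (((p - 1 : ℕ) : ℝ)) * padicValNat p n.factorial ≤ n := by exact_mod_cast h2
  rw [Nat.cast_sub hp.one_le] at h3
  push_cast at h3
  linarith

/-- Each of the `n / p` multiples of `p` up to `n` contributes at least one factor `p`; the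
induction splits off blocks of length `p`. -/
theorem le_factorization_factorial {n p : ℕ} (hp : p.Prime) :
    (n : ℝ) / p - 1 ≤ n.factorial.factorization p := by
  have h1 : n / p ≤ n.factorial.factorization p := by
    rw [← hp.pow_dvd_iff_le_factorization (Nat.factorial_ne_zero n)]
    calc p ^ (n / p) ∣ (p * (n / p)).factorial := by
          generalize n / p = m
          induction m with
          | zero => simp
          | succ m ih =>
            rw [pow_succ, Nat.mul_succ]
            exact (mul_dvd_mul ih (hp.dvd_factorial.mpr le_rfl)).trans
              (Nat.factorial_mul_factorial_dvd_factorial_add _ _)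
      _ ∣ n.factorial := Nat.factorial_dvd_factorial (Nat.mul_div_le n p)
  have h2 : ((n / p : ℕ) : ℝ) ≤ n.factorial.factorization p := by exact_mod_cast h1
  have h3 := Nat.lt_floor_add_one ((n : ℝ) / p)
  rw [Nat.floor_div_natCast, Nat.floor_natCast] at h3
  linarith

/-- This series dominates both the prime-power excess in `log n!` and the quadratic parts of the
local factors. It converges because `log n ≤ 2 √n` and `n - 1 ≥ n / 2` for `n ≥ 2`. -/
theorem summable_log_div_mul_pred :
    Summable fun n : ℕ => Real.log n / ((n : ℝ) * (n - 1)) := by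
  have h : Summable fun n : ℕ => 4 / (n : ℝ) ^ (3 / 2 : ℝ) :=
    ((Real.summable_one_div_nat_rpow (p := 3 / 2)).mpr (by norm_num)).mul_left 4 |>.congr
      fun n => by ring
  refine Summable.of_norm_bounded h fun n => ?_
  rcases Nat.lt_or_ge n 2 with hn | hn
  · interval_cases n <;> simp
  have hn' : (2 : ℝ) ≤ n := by exact_mod_cast hn
  have h1 : Real.log n ≤ (n : ℝ) ^ (1 / 2 : ℝ) / (1 / 2) :=
    Real.log_le_rpow_div (by positivity) (by norm_num)
  have h0 : 0 ≤ Real.log n := Real.log_nonneg (by linarith)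
  have h2 : (n : ℝ) ^ (3 / 2 : ℝ) * n ^ (1 / 2 : ℝ) = n * n := by
    rw [← Real.rpow_add (by positivity)]; norm_num; ring
  rw [Real.norm_of_nonneg (div_nonneg h0 (mul_nonneg (by positivity) (by linarith))),
    div_le_div_iff₀ (mul_pos (by positivity) (by linarith)) (by positivity)]
  have h3 : (0 : ℝ) ≤ (n : ℝ) ^ (3 / 2 : ℝ) := by positivity
  nlinarith [mul_le_mul_of_nonneg_right h1 h3]

/-- Mertens' first theorem at natural numbers. -/
theorem mertens_first_nat :
    ∃ B : ℝ, 0 ≤ B ∧ ∀ n : ℕ, 1 ≤ n →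
      |∑ p ∈ n.primesLE, Real.log p / p - Real.log n| ≤ B := by
  set S := ∑' n : ℕ, Real.log n / ((n : ℝ) * (n - 1)) with hS
  have hterm : ∀ n : ℕ, 0 ≤ Real.log n / ((n : ℝ) * (n - 1)) := by
    intro n
    rcases Nat.eq_zero_or_pos n with rfl | hn
    · simp
    have hn' : (1 : ℝ) ≤ n := by exact_mod_cast hn
    exact div_nonneg (Real.log_nonneg hn') (mul_nonneg (by positivity) (by linarith))
  have hS0 : 0 ≤ S := tsum_nonneg hterm
  have h4 : 0 ≤ Real.log 4 := Real.log_nonneg (by norm_num)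
  refine ⟨1 + S + Real.log 4, by positivity, fun n hn => ?_⟩
  have hn0 : (0 : ℝ) < n := by exact_mod_cast hn
  have hfac := log_factorial_eq_sum_primesLE n
  have hlow := Stirling.le_log_factorial_stirling (n := n) (by omega)
  have hup : Real.log n.factorial ≤ n * Real.log n := by
    rw [← Real.log_pow]
    exact Real.log_le_log (by positivity) (by exact_mod_cast Nat.factorial_le_pow n)
  have hpr : ∀ p ∈ n.primesLE, p.Prime := fun p hp => (Nat.mem_primesLE.mp hp).2
  -- Replacing `v_p(n!)` by `n / p - 1` costs the Chebyshev function `θ(n) ≤ n log 4`.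
  have h1 : n * (∑ p ∈ n.primesLE, Real.log p / p) - Real.log 4 * n ≤ Real.log n.factorial := by
    have hθ := Chebyshev.theta_le_log4_mul_x (x := n) hn0.le
    rw [Chebyshev.theta_eq_sum_primesLE_log] at hθ
    have : ∑ p ∈ n.primesLE, ((n : ℝ) / p - 1) * Real.log p ≤ Real.log n.factorial := by
      rw [hfac]
      refine Finset.sum_le_sum fun p hp => ?_
      exact mul_le_mul_of_nonneg_right (le_factorization_factorial (hpr p hp))
        (Real.log_natCast_nonneg p)
    have h5 : ∑ p ∈ n.primesLE, ((n : ℝ) / p - 1) * Real.log p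
        = n * (∑ p ∈ n.primesLE, Real.log p / p) - ∑ p ∈ n.primesLE, Real.log p := by
      rw [Finset.mul_sum, ← Finset.sum_sub_distrib]
      exact Finset.sum_congr rfl fun p _ => by ring
    linarith
  -- Here `1 / (p - 1) = 1 / p + 1 / (p (p - 1))`, and the second part sums to at most `S`.
  have h2 : Real.log n.factorial ≤ n * (∑ p ∈ n.primesLE, Real.log p / p) + n * S := by
    have : Real.log n.factorial ≤
        ∑ p ∈ n.primesLE, (n * (Real.log p / p) + n * (Real.log p / ((p : ℝ) * (p - 1)))) := by
      rw [hfac]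
      refine Finset.sum_le_sum fun p hp => ?_
      have hp1 : (1 : ℝ) < p := by exact_mod_cast (hpr p hp).one_lt
      calc _ ≤ n / ((p : ℝ) - 1) * Real.log p :=
            mul_le_mul_of_nonneg_right (factorization_factorial_le (hpr p hp))
              (Real.log_natCast_nonneg p)
        _ = _ := by
            have : (p : ℝ) - 1 ≠ 0 := by linarith
            field_simp
            ring
    rw [Finset.sum_add_distrib, ← Finset.mul_sum, ← Finset.mul_sum] at this
    have h6 := summable_log_div_mul_pred.sum_le_tsum n.primesLE fun p _ => hterm p
    have := mul_le_mul_of_nonneg_left h6 hn0.le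
    linarith
  have hln : 0 ≤ Real.log n := Real.log_natCast_nonneg n
  have hpi : 0 ≤ Real.log (2 * Real.pi) := Real.log_nonneg (by nlinarith [Real.pi_gt_three])
  rw [abs_le]
  constructor
  · have : n * (-(1 + S + Real.log 4)) ≤
        n * (∑ p ∈ n.primesLE, Real.log p / p - Real.log n) := by nlinarith
    exact le_of_mul_le_mul_left this hn0
  · have : n * (∑ p ∈ n.primesLE, Real.log p / p - Real.log n) ≤
        n * (1 + S + Real.log 4) := by nlinarith
    exact le_of_mul_le_mul_left this hn0

/-- The weight `log p / p` on primes, extended by zero. -/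
noncomputable def logPrimeWeight (n : ℕ) : ℝ := if n.Prime then Real.log n / n else 0

theorem sum_Icc_mul_logPrimeWeight (h : ℕ → ℂ) (n : ℕ) :
    ∑ m ∈ Finset.Icc 0 n, h m * (logPrimeWeight m : ℂ)
      = ∑ p ∈ n.primesLE, h p * ((Real.log p / p : ℝ) : ℂ) := by
  rw [Nat.primesLE_eq_filter_Icc_zero, Finset.sum_filter]
  refine Finset.sum_congr rfl fun m _ => ?_
  unfold logPrimeWeight
  split_ifs <;> simp

/-- Mertens' first theorem. -/
theorem mertens_first :
    ∃ B : ℝ, 0 ≤ B ∧ ∀ x : ℝ, 1 ≤ x →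
      |∑ m ∈ Finset.Icc 0 ⌊x⌋₊, logPrimeWeight m - Real.log x| ≤ B := by
  obtain ⟨B, hB0, hB⟩ := mertens_first_nat
  refine ⟨B + 1, by positivity, fun x hx => ?_⟩
  have hx1 : 1 ≤ ⌊x⌋₊ := Nat.one_le_floor_iff x |>.mpr hx
  have hx1' : (1 : ℝ) ≤ ⌊x⌋₊ := by exact_mod_cast hx1
  have h := hB _ hx1
  have hsum : ∑ m ∈ Finset.Icc 0 ⌊x⌋₊, logPrimeWeight m
      = ∑ p ∈ (⌊x⌋₊).primesLE, Real.log p / p := by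
    rw [Nat.primesLE_eq_filter_Icc_zero, Finset.sum_filter]
    rfl
  rw [hsum]
  have hle : Real.log ⌊x⌋₊ ≤ Real.log x :=
    Real.log_le_log (by linarith) (Nat.floor_le (by linarith))
  have hge : Real.log x ≤ Real.log ⌊x⌋₊ + 1 := by
    have h2 : Real.log x - Real.log ⌊x⌋₊ ≤ x / ⌊x⌋₊ - 1 := by
      rw [← Real.log_div (by linarith) (by linarith)]
      exact Real.log_le_sub_one_of_pos (by positivity)
    have h3 : x / ⌊x⌋₊ ≤ 2 := by
      rw [div_le_iff₀ (by linarith)]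
      have := Nat.lt_floor_add_one x
      linarith
    linarith
  rw [abs_le] at h ⊢
  constructor <;> linarith [h.1, h.2]

/-- The error term in Mertens' first theorem. -/
noncomputable def mertensError (x : ℝ) : ℝ :=
  ∑ m ∈ Finset.Icc 0 ⌊x⌋₊, logPrimeWeight m - Real.log x

theorem measurable_mertensError : Measurable mertensError := by
  unfold mertensError
  refine Measurable.sub ?_ Real.measurable_log
  exact (measurable_from_nat (f := fun n : ℕ => ∑ m ∈ Finset.Icc 0 n, logPrimeWeight m)).comp
    Nat.measurable_floor

/-! ### Partial summation and Mertens' second theorem -/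

/-- Partial summation over primes against Mertens' first theorem. -/
theorem sum_mul_logPrimeWeight_eq (h h' : ℝ → ℂ) {b : ℝ} (hb : 2 ≤ b)
    (hd : ∀ x ∈ Set.Icc 2 b, HasDerivAt h (h' x) x) (hc : ContinuousOn h' (Set.Icc 2 b)) :
    ∑ m ∈ Finset.Icc 0 ⌊b⌋₊, h m * (logPrimeWeight m : ℂ) =
      h 2 * Real.log 2 + (∫ x in (2 : ℝ)..b, h x / x) + h b * mertensError b
        - ∫ x in (2 : ℝ)..b, h' x * mertensError x := by
  have hderiv : ∀ x ∈ Set.Icc 2 b, deriv h x = h' x := fun x hx => (hd x hx).deriv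
  have hint : IntegrableOn (deriv h) (Set.Icc 2 b) :=
    (hc.integrableOn_compact isCompact_Icc).congr_fun (fun x hx => (hderiv x hx).symm)
      measurableSet_Icc
  -- The weight vanishes at `0` and `1`, so the integral may start at `2`. Its `log x` part is then
  -- integrated back by parts, leaving only the bounded Mertens error.
  have habel := sum_mul_eq_sub_integral_mul₁ (f := h) (fun n => (logPrimeWeight n : ℂ))
    (by simp [logPrimeWeight]) (by simp [logPrimeWeight, Nat.not_prime_one]) b
    (fun x hx => (hd x hx).differentiableAt) hint
  have hsplit : ∀ x : ℝ, ∑ m ∈ Finset.Icc 0 ⌊x⌋₊, (logPrimeWeight m : ℂ)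
      = Real.log x + mertensError x := by
    intro x
    unfold mertensError
    push_cast
    ring
  have hpos : ∀ x ∈ Set.uIcc 2 b, x ≠ 0 := fun x hx => by
    rw [Set.uIcc_of_le hb] at hx; linarith [hx.1]
  have hlogc : ContinuousOn (fun x : ℝ => ((Real.log x : ℝ) : ℂ)) (Set.uIcc 2 b) :=
    Complex.continuous_ofReal.comp_continuousOn (Real.continuousOn_log.mono hpos)
  have hc' : ContinuousOn h' (Set.uIcc 2 b) := by rwa [Set.uIcc_of_le hb]
  have hlogd : ∀ x ∈ Set.uIcc 2 b,
      HasDerivAt (fun x : ℝ => ((Real.log x : ℝ) : ℂ)) (((x⁻¹ : ℝ)) : ℂ) x := fun x hx =>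
    (Real.hasDerivAt_log (hpos x hx)).ofReal_comp
  have hinvc : ContinuousOn (fun x : ℝ => ((x⁻¹ : ℝ) : ℂ)) (Set.uIcc 2 b) :=
    Complex.continuous_ofReal.comp_continuousOn (continuousOn_inv₀.mono hpos)
  have hparts := intervalIntegral.integral_mul_deriv_eq_deriv_mul (u := h) (u' := h')
    (fun x hx => hd x (by rwa [Set.uIcc_of_le hb] at hx)) hlogd hc'.intervalIntegrable
    hinvc.intervalIntegrable
  have hI1 : IntervalIntegrable (fun x => h' x * ((Real.log x : ℝ) : ℂ)) volume 2 b :=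
    (hc'.mul hlogc).intervalIntegrable
  have hI2 : IntervalIntegrable (fun x => h' x * (mertensError x : ℂ)) volume 2 b := by
    have h1 : IntegrableOn (fun x => h' x * ∑ m ∈ Finset.Icc 0 ⌊x⌋₊, (logPrimeWeight m : ℂ))
        (Set.Icc 2 b) := by
      exact integrableOn_mul_sum_Icc (fun n => (logPrimeWeight n : ℂ)) (by norm_num)
        (hc.integrableOn_compact isCompact_Icc)
    have h2 : IntervalIntegrable
        (fun x => h' x * ∑ m ∈ Finset.Icc 0 ⌊x⌋₊, (logPrimeWeight m : ℂ)) volume 2 b :=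
      (intervalIntegrable_iff_integrableOn_Icc_of_le hb).mpr h1
    refine (h2.sub hI1).congr fun x _ => ?_
    rw [hsplit]
    ring
  rw [habel, hsplit, ← intervalIntegral.integral_of_le hb]
  have h3 : ∫ x in (2 : ℝ)..b, deriv h x * ∑ m ∈ Finset.Icc 0 ⌊x⌋₊, (logPrimeWeight m : ℂ)
      = (∫ x in (2 : ℝ)..b, h' x * ((Real.log x : ℝ) : ℂ))
        + ∫ x in (2 : ℝ)..b, h' x * (mertensError x : ℂ) := by
    rw [← intervalIntegral.integral_add hI1 hI2]
    refine intervalIntegral.integral_congr fun x hx => ?_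
    rw [Set.uIcc_of_le hb] at hx
    rw [hderiv x hx, hsplit]
    ring
  have h4 : ∫ x in (2 : ℝ)..b, h x / x = ∫ x in (2 : ℝ)..b, h x * ((x⁻¹ : ℝ) : ℂ) := by
    refine intervalIntegral.integral_congr fun x _ => ?_
    simp [div_eq_mul_inv]
  rw [h3, h4, hparts]
  ring

theorem hasDerivAt_neg_inv_log {x : ℝ} (hx : 1 < x) :
    HasDerivAt (fun x => -(Real.log x)⁻¹) (1 / (x * Real.log x ^ 2)) x := by
  have hl := Real.log_pos hx
  exact ((Real.hasDerivAt_log (by linarith)).inv hl.ne').neg.congr_deriv (by field_simp)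

theorem integrableOn_inv_mul_log_sq {a : ℝ} (ha : 1 < a) :
    IntegrableOn (fun x : ℝ => 1 / (x * Real.log x ^ 2)) (Set.Ioi a) ∧
      ∫ x in Set.Ioi a, 1 / (x * Real.log x ^ 2) = 1 / Real.log a := by
  have hlim : Tendsto (fun x => -(Real.log x)⁻¹) atTop (𝓝 0) := by
    simpa using (tendsto_inv_atTop_zero.comp Real.tendsto_log_atTop).neg
  have hd : ∀ x ∈ Set.Ici a, HasDerivAt (fun x => -(Real.log x)⁻¹) (1 / (x * Real.log x ^ 2)) x :=
    fun x hx => hasDerivAt_neg_inv_log (lt_of_lt_of_le ha hx)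
  have hn : ∀ x ∈ Set.Ioi a, 0 ≤ 1 / (x * Real.log x ^ 2) := fun x hx => by
    have : 0 < x := by linarith [Set.mem_Ioi.mp hx]
    positivity
  refine ⟨integrableOn_Ioi_deriv_of_nonneg' hd hn hlim, ?_⟩
  rw [integral_Ioi_of_hasDerivAt_of_nonneg' hd hn hlim]
  simp

theorem integral_inv_mul_log {b : ℝ} (hb : 2 ≤ b) :
    ∫ x in (2 : ℝ)..b, 1 / (x * Real.log x) =
      Real.log (Real.log b) - Real.log (Real.log 2) := by
  have hmem : ∀ x ∈ Set.uIcc 2 b, 2 ≤ x := fun x hx => by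
    rw [Set.uIcc_of_le hb] at hx; exact hx.1
  refine intervalIntegral.integral_eq_sub_of_hasDerivAt (f := fun x => Real.log (Real.log x))
    (fun x hx => ?_) ?_
  · have h2 := hmem x hx
    have hl := Real.log_pos (by linarith : 1 < x)
    exact ((Real.hasDerivAt_log (by linarith : x ≠ 0)).log hl.ne').congr_deriv (by field_simp)
  · refine ContinuousOn.intervalIntegrable fun x hx => ContinuousAt.continuousWithinAt ?_
    have h2 := hmem x hx
    have hl := Real.log_pos (by linarith : 1 < x)
    have := Real.continuousAt_log (by linarith : x ≠ 0)
    exact continuousAt_const.div (continuousAt_id.mul this)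
      (mul_ne_zero (by simp; linarith) hl.ne')

/-- Mertens' second theorem. -/
theorem mertens_second :
    ∃ M A : ℝ, 0 ≤ A ∧ ∀ N : ℕ, 2 ≤ N →
      ‖∑ p ∈ N.primesLE, (1 / p : ℂ) - (Real.log (Real.log N) + M : ℝ)‖ ≤ A / Real.log N := by
  obtain ⟨B, hB0, hB⟩ := mertens_first
  set g : ℝ → ℝ := fun x => 1 / (x * Real.log x ^ 2) * mertensError x with hg
  -- Partial summation with `h = 1 / log x`: the boundary term at `2` is `1`, and the error integral
  -- is completed to infinity. The boundary term at `N` and the removed tail each cost `B / log N`.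
  refine ⟨1 - Real.log (Real.log 2) + ∫ x in Set.Ioi 2, g x, 2 * B, by positivity, fun N hN => ?_⟩
  have hN2 : (2 : ℝ) ≤ N := by exact_mod_cast hN
  have hL : 0 < Real.log N := Real.log_pos (by linarith)
  have hgm : Measurable g := by
    have := measurable_mertensError
    rw [hg]
    fun_prop
  have hgb : ∀ a : ℝ, 2 ≤ a → ∀ x ∈ Set.Ioi a, ‖g x‖ ≤ B * (1 / (x * Real.log x ^ 2)) := by
    intro a ha x hx
    have hx0 : 0 < x := by linarith [Set.mem_Ioi.mp hx]
    rw [hg, norm_mul, mul_comm, Real.norm_of_nonneg (r := 1 / _) (by positivity)]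
    exact mul_le_mul_of_nonneg_right (hB x (by linarith [Set.mem_Ioi.mp hx])) (by positivity)
  have hgi : ∀ a : ℝ, 2 ≤ a → IntegrableOn g (Set.Ioi a) := fun a ha =>
    ((integrableOn_inv_mul_log_sq (by linarith : 1 < a)).1.const_mul B).mono'
      hgm.aestronglyMeasurable ((ae_restrict_iff' measurableSet_Ioi).mpr
        (Eventually.of_forall (hgb a ha)))
  have htail : ‖∫ x in Set.Ioi (N : ℝ), g x‖ ≤ B / Real.log N := by
    calc _ ≤ ∫ x in Set.Ioi (N : ℝ), B * (1 / (x * Real.log x ^ 2)) :=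
          norm_integral_le_of_norm_le
            ((integrableOn_inv_mul_log_sq (by linarith)).1.const_mul B)
            ((ae_restrict_iff' measurableSet_Ioi).mpr (Eventually.of_forall (hgb N hN2)))
      _ = B / Real.log N := by
          rw [integral_const_mul, (integrableOn_inv_mul_log_sq (by linarith)).2]; ring
  have hmem : ∀ x ∈ Set.Icc (2 : ℝ) N, 0 < x ∧ 0 < Real.log x := fun x hx =>
    ⟨by linarith [hx.1], Real.log_pos (by linarith [hx.1])⟩
  have habel := sum_mul_logPrimeWeight_eq (fun x => (((Real.log x)⁻¹ : ℝ) : ℂ))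
    (fun x => ((-(1 / (x * Real.log x ^ 2)) : ℝ) : ℂ)) hN2
    (fun x hx => by
      have := (hasDerivAt_neg_inv_log (x := x) (by linarith [hx.1])).neg
      simp only [Pi.neg_def, neg_neg] at this
      exact this.ofReal_comp)
    (by
      refine fun x hx => ContinuousAt.continuousWithinAt ?_
      obtain ⟨h1, h2⟩ := hmem x hx
      have := Real.continuousAt_log h1.ne'
      refine Complex.continuous_ofReal.continuousAt.comp (ContinuousAt.neg ?_)
      exact continuousAt_const.div (continuousAt_id.mul (this.pow 2))
        (mul_ne_zero (by simpa using h1.ne') (by positivity)))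
  rw [Nat.floor_natCast, sum_Icc_mul_logPrimeWeight (fun n => (((Real.log n)⁻¹ : ℝ) : ℂ))] at habel
  have hsum : ∑ p ∈ N.primesLE, (1 / p : ℂ)
      = ∑ p ∈ N.primesLE, (((Real.log p)⁻¹ : ℝ) : ℂ) * ((Real.log p / p : ℝ) : ℂ) := by
    refine Finset.sum_congr rfl fun p hp => ?_
    have h2 := (Nat.mem_primesLE.mp hp).2.one_lt
    have : 0 < Real.log p := Real.log_pos (by exact_mod_cast h2)
    rw [← Complex.ofReal_mul, ← mul_div_assoc, inv_mul_cancel₀ this.ne']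
    push_cast
    rfl
  have hmain : ∫ x in (2 : ℝ)..N, (((Real.log x)⁻¹ : ℝ) : ℂ) / x
      = ((Real.log (Real.log N) - Real.log (Real.log 2) : ℝ) : ℂ) := by
    rw [← integral_inv_mul_log hN2, ← intervalIntegral.integral_ofReal]
    refine intervalIntegral.integral_congr fun x _ => ?_
    push_cast
    rw [one_div, mul_inv, div_eq_mul_inv, mul_comm]
  have herr : ∫ x in (2 : ℝ)..N, ((-(1 / (x * Real.log x ^ 2)) : ℝ) : ℂ) * mertensError x
      = ((-((∫ x in Set.Ioi 2, g x) - ∫ x in Set.Ioi (N : ℝ), g x) : ℝ) : ℂ) := by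
    rw [intervalIntegral.integral_Ioi_sub_Ioi (hgi 2 le_rfl) hN2,
      ← intervalIntegral.integral_neg,
      ← intervalIntegral.integral_ofReal]
    refine intervalIntegral.integral_congr fun x _ => ?_
    simp only [hg]
    push_cast
    ring
  rw [hsum, habel, hmain, herr]
  have h2 : Real.log 2 ≠ 0 := (Real.log_pos (by norm_num)).ne'
  have hcomb : (((Real.log 2)⁻¹ : ℝ) : ℂ) * Real.log 2
      + ((Real.log (Real.log N) - Real.log (Real.log 2) : ℝ) : ℂ)
      + (((Real.log N)⁻¹ : ℝ) : ℂ) * mertensError N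
      - ((-((∫ x in Set.Ioi 2, g x) - ∫ x in Set.Ioi (N : ℝ), g x) : ℝ) : ℂ)
      - (Real.log (Real.log N) + (1 - Real.log (Real.log 2) + ∫ x in Set.Ioi 2, g x) : ℝ)
      = (((Real.log N)⁻¹ * mertensError N - ∫ x in Set.Ioi (N : ℝ), g x : ℝ) : ℂ) := by
    rw [← Complex.ofReal_mul, inv_mul_cancel₀ h2]
    push_cast
    ring
  rw [hcomb, Complex.norm_real]
  have h5 : ‖(Real.log N)⁻¹ * mertensError N‖ ≤ B / Real.log N := by
    rw [norm_mul, Real.norm_of_nonneg (inv_nonneg.mpr hL.le), div_eq_mul_inv, mul_comm]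
    exact mul_le_mul_of_nonneg_right (hB N (by linarith)) (inv_nonneg.mpr hL.le)
  calc _ ≤ _ := norm_sub_le _ _
    _ ≤ B / Real.log N + B / Real.log N := add_le_add h5 htail
    _ = _ := by ring

/-! ### Twisted prime sums -/

/-- The exponent in `phi`: the integral `∫₀¹ (e^{i t v} - 1) / v dv`. -/
noncomputable def oscIntegral (t : ℝ) : ℂ :=
  ∫ v in (0 : ℝ)..1, (Complex.exp (Complex.I * t * v) - 1) / (v : ℂ)

theorem norm_exp_I_mul_sub_one_le (t v : ℝ) :
    ‖Complex.exp (Complex.I * t * v) - 1‖ ≤ |t| * |v| := by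
  have := Real.norm_exp_I_mul_ofReal_sub_one_le (x := t * v)
  rw [Real.norm_eq_abs, abs_mul] at this
  simpa [mul_assoc] using this

theorem norm_exp_I_mul_mul (t v : ℝ) : ‖Complex.exp (Complex.I * t * v)‖ = 1 := by
  have := Complex.norm_exp_I_mul_ofReal (t * v)
  simpa [mul_assoc] using this

theorem norm_exp_I_mul_sub_one_div_le (t v : ℝ) :
    ‖(Complex.exp (Complex.I * t * v) - 1) / (v : ℂ)‖ ≤ |t| := by
  -- At `v = 0` the quotient is `0` by the convention on division, so the bound needs no exception.
  rcases eq_or_ne v 0 with rfl | hv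
  · simp
  rw [norm_div, Complex.norm_real, Real.norm_eq_abs, div_le_iff₀ (abs_pos.mpr hv)]
  exact norm_exp_I_mul_sub_one_le t v

theorem intervalIntegrable_exp_sub_one_div (t a b : ℝ) :
    IntervalIntegrable (fun v : ℝ => (Complex.exp (Complex.I * t * v) - 1) / (v : ℂ))
      volume a b := by
  refine (intervalIntegrable_const (c := |t|)).mono_fun' ?_ ?_
  · exact Measurable.aestronglyMeasurable (by fun_prop)
  · exact Eventually.of_forall fun v => norm_exp_I_mul_sub_one_div_le t v

theorem hasDerivAt_exp_log_sub_one_div_log (t : ℝ) {x : ℝ} (hx : 1 < x) :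
    HasDerivAt (fun x : ℝ => (Complex.exp (Complex.I * t * (Real.log x : ℝ)) - 1)
        / (Real.log x : ℝ))
      ((Complex.exp (Complex.I * t * (Real.log x : ℝ)) * (Complex.I * t * ((x⁻¹ : ℝ) : ℂ))
          * (Real.log x : ℝ)
        - (Complex.exp (Complex.I * t * (Real.log x : ℝ)) - 1) * ((x⁻¹ : ℝ) : ℂ))
          / ((Real.log x : ℝ) : ℂ) ^ 2) x := by
  have hl := Real.log_pos hx
  have h1 : HasDerivAt (fun x : ℝ => ((Real.log x : ℝ) : ℂ)) ((x⁻¹ : ℝ) : ℂ) x :=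
    (Real.hasDerivAt_log (by linarith)).ofReal_comp
  have h2 := ((h1.const_mul (Complex.I * t)).cexp.sub_const 1).div h1
    (by exact_mod_cast hl.ne')
  exact h2

theorem norm_deriv_exp_log_sub_one_div_log_le (t : ℝ) {x : ℝ} (hx : 1 < x) :
    ‖(Complex.exp (Complex.I * t * (Real.log x : ℝ)) * (Complex.I * t * ((x⁻¹ : ℝ) : ℂ))
          * (Real.log x : ℝ)
        - (Complex.exp (Complex.I * t * (Real.log x : ℝ)) - 1) * ((x⁻¹ : ℝ) : ℂ))
          / ((Real.log x : ℝ) : ℂ) ^ 2‖ ≤ 2 * |t| * (1 / (x * Real.log x)) := by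
  have hl := Real.log_pos hx
  have hx0 : 0 < x := by linarith
  have hnl : ‖((Real.log x : ℝ) : ℂ)‖ = Real.log x := by
    rw [Complex.norm_real, Real.norm_of_nonneg hl.le]
  have hnx : ‖((x⁻¹ : ℝ) : ℂ)‖ = x⁻¹ := by
    rw [Complex.norm_real, Real.norm_of_nonneg (by positivity)]
  rw [norm_div, norm_pow, hnl, div_le_iff₀ (by positivity)]
  calc _ ≤ _ := norm_sub_le _ _
    _ ≤ |t| * x⁻¹ * Real.log x + |t| * |Real.log x| * x⁻¹ := by
        refine add_le_add ?_ ?_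
        · rw [norm_mul, norm_mul, norm_exp_I_mul_mul, norm_mul, norm_mul, hnl, hnx,
            Complex.norm_I, Complex.norm_real, Real.norm_eq_abs, one_mul, one_mul]
        · rw [norm_mul, hnx]
          exact mul_le_mul_of_nonneg_right (norm_exp_I_mul_sub_one_le t _) (by positivity)
    _ = _ := by
        rw [abs_of_pos hl]
        field_simp
        ring

/-- Subtracting `1` from `p ^ (i t)` makes the partial summation kernel `(x ^ (i t) - 1) / log x`
bounded by `|t|`, with derivative at most `2 |t| / (x log x)`. The error therefore carries a factor
`|t|`, apart from the boundary term at `N`; this is decisive when `t = l / log N`. -/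
theorem sum_twisted_sub_integral :
    ∃ A : ℝ, 0 ≤ A ∧ ∀ N : ℕ, 2 ≤ N → ∀ t : ℝ,
      ‖∑ p ∈ N.primesLE, (Complex.exp (Complex.I * t * (Real.log p : ℝ)) - 1) / p
        - ∫ x in (2 : ℝ)..N, (Complex.exp (Complex.I * t * (Real.log x : ℝ)) - 1)
            / (Real.log x : ℝ) / x‖
        ≤ A / Real.log N
          + A * |t| * (1 + (Real.log (Real.log N) - Real.log (Real.log 2))) := by
  obtain ⟨B, hB0, hB⟩ := mertens_first
  refine ⟨2 * B + 1, by positivity, fun N hN t => ?_⟩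
  have hN2 : (2 : ℝ) ≤ N := by exact_mod_cast hN
  have hL : 0 < Real.log N := Real.log_pos (by linarith)
  have hLL : Real.log (Real.log 2) ≤ Real.log (Real.log N) :=
    Real.log_le_log (Real.log_pos (by norm_num)) (Real.log_le_log (by norm_num) hN2)
  have hmem : ∀ x ∈ Set.Icc (2 : ℝ) N, 1 < x := fun x hx => by linarith [hx.1]
  have habel := sum_mul_logPrimeWeight_eq _ _ hN2
    (fun x hx => hasDerivAt_exp_log_sub_one_div_log t (hmem x hx))
    (by
      have hlc : ContinuousOn (fun x : ℝ => ((Real.log x : ℝ) : ℂ)) (Set.Icc 2 N) :=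
        Complex.continuous_ofReal.comp_continuousOn
          (Real.continuousOn_log.mono fun x hx => by
            have := hmem x hx; simp; linarith)
      have hic : ContinuousOn (fun x : ℝ => ((x⁻¹ : ℝ) : ℂ)) (Set.Icc 2 N) :=
        Complex.continuous_ofReal.comp_continuousOn
          (continuousOn_inv₀.mono fun x hx => by have := hmem x hx; simp; linarith)
      have hec : ContinuousOn (fun x : ℝ => Complex.exp (Complex.I * t * (Real.log x : ℝ)))
          (Set.Icc 2 N) := (continuousOn_const.mul hlc).cexp
      refine ContinuousOn.div (((hec.mul (continuousOn_const.mul hic)).mul hlc).sub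
        ((hec.sub continuousOn_const).mul hic)) (hlc.pow 2) fun x hx => ?_
      have := Real.log_pos (hmem x hx)
      exact pow_ne_zero 2 (by exact_mod_cast this.ne'))
  rw [Nat.floor_natCast, sum_Icc_mul_logPrimeWeight (fun n =>
    (Complex.exp (Complex.I * t * (Real.log n : ℝ)) - 1) / (Real.log n : ℝ))] at habel
  have hsum : ∑ p ∈ N.primesLE, (Complex.exp (Complex.I * t * (Real.log p : ℝ)) - 1) / (p : ℂ)
      = ∑ p ∈ N.primesLE, (Complex.exp (Complex.I * t * (Real.log p : ℝ)) - 1)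
          / (Real.log p : ℝ) * ((Real.log p / p : ℝ) : ℂ) := by
    refine Finset.sum_congr rfl fun p hp => ?_
    have h2 := (Nat.mem_primesLE.mp hp).2.one_lt
    have : (Real.log p : ℂ) ≠ 0 := by
      exact_mod_cast (Real.log_pos (by exact_mod_cast h2 : (1 : ℝ) < p)).ne'
    rw [Complex.ofReal_div, Complex.ofReal_natCast, ← mul_div_assoc, div_mul_cancel₀ _ this]
  rw [hsum, habel]
  set h : ℝ → ℂ := fun x => (Complex.exp (Complex.I * t * (Real.log x : ℝ)) - 1)
    / (Real.log x : ℝ) with hh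
  have hrearr : ∀ a b c d : ℂ, a + b + c - d - b = a + c - d := fun a b c d => by ring
  rw [hrearr]
  have e1 : ‖h 2 * ((Real.log 2 : ℝ) : ℂ)‖ ≤ |t| := by
    rw [norm_mul, Complex.norm_real, Real.norm_of_nonneg (Real.log_nonneg (by norm_num))]
    have h1 : ‖h 2‖ ≤ |t| := norm_exp_I_mul_sub_one_div_le t _
    have h2 : Real.log 2 ≤ 1 := by linarith [Real.log_two_lt_d9]
    have h3 : 0 ≤ Real.log 2 := Real.log_nonneg (by norm_num)
    nlinarith [abs_nonneg t]
  have e2 : ‖h N * (mertensError N : ℂ)‖ ≤ 2 * B / Real.log N := by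
    have h1 : ‖h N‖ ≤ 2 / Real.log N := by
      rw [hh, norm_div, Complex.norm_real, Real.norm_of_nonneg hL.le]
      refine div_le_div_of_nonneg_right ?_ hL.le
      refine (norm_sub_le _ _).trans ?_
      rw [norm_exp_I_mul_mul, norm_one]
      norm_num
    have h2 : ‖(mertensError N : ℂ)‖ ≤ B := by
      rw [Complex.norm_real]; exact hB N (by linarith)
    rw [norm_mul]
    calc _ ≤ 2 / Real.log N * B := mul_le_mul h1 h2 (norm_nonneg _) (by positivity)
      _ = _ := by ring
  have e3 : ‖∫ x in (2 : ℝ)..N,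
      (Complex.exp (Complex.I * t * (Real.log x : ℝ)) * (Complex.I * t * ((x⁻¹ : ℝ) : ℂ))
          * (Real.log x : ℝ)
        - (Complex.exp (Complex.I * t * (Real.log x : ℝ)) - 1) * ((x⁻¹ : ℝ) : ℂ))
          / ((Real.log x : ℝ) : ℂ) ^ 2 * (mertensError x : ℂ)‖
      ≤ 2 * |t| * B * (Real.log (Real.log N) - Real.log (Real.log 2)) := by
    rw [← integral_inv_mul_log hN2, ← intervalIntegral.integral_const_mul]
    refine intervalIntegral.norm_integral_le_of_norm_le hN2
      (Eventually.of_forall fun x hx => ?_) ?_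
    · have hx1 := hmem x ⟨hx.1.le, hx.2⟩
      have hl := Real.log_pos hx1
      rw [norm_mul, Complex.norm_real]
      calc _ ≤ (2 * |t| * (1 / (x * Real.log x))) * B :=
            mul_le_mul (norm_deriv_exp_log_sub_one_div_log_le t hx1) (hB x hx1.le)
              (abs_nonneg _) (by positivity)
        _ = _ := by ring
    · refine ContinuousOn.intervalIntegrable fun x hx => ContinuousAt.continuousWithinAt ?_
      rw [Set.uIcc_of_le hN2] at hx
      have h2 := hmem x hx
      have hl := Real.log_pos h2
      have := Real.continuousAt_log (by linarith : x ≠ 0)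
      exact continuousAt_const.mul (continuousAt_const.div (continuousAt_id.mul this)
        (mul_ne_zero (by simp; linarith) hl.ne'))
  calc _ ≤ _ := norm_sub_le _ _
    _ ≤ (|t| + 2 * B / Real.log N)
        + 2 * |t| * B * (Real.log (Real.log N) - Real.log (Real.log 2)) :=
      add_le_add ((norm_add_le _ _).trans (add_le_add e1 e2)) e3
    _ ≤ _ := by
      have h1 : 0 ≤ 1 / Real.log N := by positivity
      have h2 := abs_nonneg t
      have h3 : 0 ≤ |t| * (Real.log (Real.log N) - Real.log (Real.log 2)) :=
        mul_nonneg h2 (by linarith)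
      have h4 : 0 ≤ B * |t| := mul_nonneg hB0 h2
      have h5 : (2 * B + 1) / Real.log N = 2 * B / Real.log N + 1 / Real.log N := by ring
      rw [h5]
      nlinarith

/-- The substitution `v = log x / log N` yields the integrand of `oscIntegral` on `[log 2 / log N,
1]`. On the missing initial segment it is at most `|l|`. -/
theorem norm_integral_log_sub_oscIntegral_le {N : ℕ} (hN : 2 ≤ N) (l : ℝ) :
    ‖(∫ x in (2 : ℝ)..N, (Complex.exp (Complex.I * (l / Real.log N : ℝ) * (Real.log x : ℝ)) - 1)
            / (Real.log x : ℝ) / x) - oscIntegral l‖ ≤ |l| / Real.log N := by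
  have hN2 : (2 : ℝ) ≤ N := by exact_mod_cast hN
  have hL : 0 < Real.log N := Real.log_pos (by linarith)
  have hmem : ∀ x ∈ Set.uIcc (2 : ℝ) N, 1 < x := fun x hx => by
    rw [Set.uIcc_of_le hN2] at hx; linarith [hx.1]
  have hsubst : (∫ x in (2 : ℝ)..N,
      (Complex.exp (Complex.I * (l / Real.log N : ℝ) * (Real.log x : ℝ)) - 1)
            / (Real.log x : ℝ) / x)
      = ∫ v in (Real.log 2 / Real.log N)..1, (Complex.exp (Complex.I * l * v) - 1) / (v : ℂ) := by
    have h := intervalIntegral.integral_deriv_smul_comp' (a := 2) (b := N)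
      (f := fun x : ℝ => Real.log x / Real.log N)
      (f' := fun x : ℝ => x⁻¹ / Real.log N)
      (g := fun v : ℝ => (Complex.exp (Complex.I * l * v) - 1) / (v : ℂ))
      (fun x hx => (Real.hasDerivAt_log (by linarith [hmem x hx])).div_const _)
      ((continuousOn_inv₀.mono fun x hx => by have := hmem x hx; simp; linarith).div_const _)
      (by
        rintro v ⟨x, hx, rfl⟩
        have h1 := Real.log_pos (hmem x hx)
        refine ContinuousAt.continuousWithinAt ?_
        refine ContinuousAt.div (by fun_prop) (by fun_prop) ?_
        simp only
        exact_mod_cast (div_pos h1 hL).ne')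
    simp only [div_self hL.ne'] at h
    rw [← h]
    refine intervalIntegral.integral_congr fun x hx => ?_
    have h1 : ((Real.log x : ℝ) : ℂ) ≠ 0 := by exact_mod_cast (Real.log_pos (hmem x hx)).ne'
    have h2 : ((Real.log N : ℝ) : ℂ) ≠ 0 := by exact_mod_cast hL.ne'
    have h3 : (x : ℂ) ≠ 0 := by
      have := hmem x hx
      exact_mod_cast (by linarith : x ≠ 0)
    simp only [Function.comp, Complex.real_smul]
    have h4 : Complex.I * l * ((Real.log x / Real.log N : ℝ) : ℂ)
        = Complex.I * (l / Real.log N : ℝ) * (Real.log x : ℝ) := by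
      push_cast; ring
    rw [h4]
    generalize Complex.exp _ = E
    rw [Complex.ofReal_div, Complex.ofReal_div, Complex.ofReal_inv]
    field_simp
  rw [hsubst, oscIntegral, ← intervalIntegral.integral_add_adjacent_intervals
    (intervalIntegrable_exp_sub_one_div l 0 (Real.log 2 / Real.log N))
    (intervalIntegrable_exp_sub_one_div l (Real.log 2 / Real.log N) 1), sub_add_cancel_right,
    norm_neg]
  have h := intervalIntegral.norm_integral_le_of_norm_le_const (a := 0)
    (b := Real.log 2 / Real.log N) (C := |l|) fun v _ => norm_exp_I_mul_sub_one_div_le l v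
  refine h.trans ?_
  have h2 : Real.log 2 ≤ 1 := by linarith [Real.log_two_lt_d9]
  have h3 : 0 ≤ Real.log 2 := Real.log_nonneg (by norm_num)
  rw [sub_zero, abs_of_nonneg (div_nonneg h3 hL.le), ← mul_div_assoc]
  exact div_le_div_of_nonneg_right (by nlinarith [abs_nonneg l]) hL.le

/-- Prime sums twisted by `p ^ (i l / log N)`, uniformly in `l`. -/
theorem sum_primes_exp_div_asymptotic :
    ∃ M A : ℝ, 0 ≤ A ∧ ∀ᶠ N : ℕ in atTop, ∀ l : ℝ,
      ‖∑ p ∈ N.primesLE, Complex.exp (Complex.I * (l / Real.log N : ℝ) * (Real.log p : ℝ)) / p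
          - ((Real.log (Real.log N) + M : ℝ) + oscIntegral l)‖
        ≤ A * ((1 + |l|) * (Real.log (Real.log N) / Real.log N)) := by
  obtain ⟨M, A₁, hA₁, h₁⟩ := mertens_second
  obtain ⟨A₂, hA₂, h₂⟩ := sum_twisted_sub_integral
  refine ⟨M, A₁ + A₂ * 3 + 1, by positivity, ?_⟩
  have hLL : ∀ᶠ N : ℕ in atTop, 1 ≤ Real.log (Real.log N) :=
    (Real.tendsto_log_atTop.comp
      (Real.tendsto_log_atTop.comp tendsto_natCast_atTop_atTop)).eventually_ge_atTop 1
  filter_upwards [hLL, eventually_ge_atTop 2] with N hLL hN l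
  have hN2 : (2 : ℝ) ≤ N := by exact_mod_cast hN
  have hL : 0 < Real.log N := Real.log_pos (by linarith)
  have e1 := h₁ N hN
  have e2 := h₂ N hN (l / Real.log N)
  have e3 := norm_integral_log_sub_oscIntegral_le hN l
  have hsplit : ∑ p ∈ N.primesLE,
      Complex.exp (Complex.I * (l / Real.log N : ℝ) * (Real.log p : ℝ)) / p
      = ∑ p ∈ N.primesLE,
        (Complex.exp (Complex.I * (l / Real.log N : ℝ) * (Real.log p : ℝ)) - 1) / p
        + ∑ p ∈ N.primesLE, (1 / p : ℂ) := by
    rw [← Finset.sum_add_distrib]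
    exact Finset.sum_congr rfl fun p _ => by ring
  rw [hsplit]
  have htri : ∀ a b c d e : ℂ, a + b - (c + d) = (a - e) + (b - c) + (e - d) := by
    intros; ring
  rw [htri _ _ _ _ (∫ x in (2 : ℝ)..N,
    (Complex.exp (Complex.I * (l / Real.log N : ℝ) * (Real.log x : ℝ)) - 1)
            / (Real.log x : ℝ) / x)]
  refine (norm_add_le _ _).trans ((add_le_add ((norm_add_le _ _).trans (add_le_add e2 e1))
    e3).trans ?_)
  rw [abs_div, abs_of_pos hL]
  -- With `LL ≥ 1` this gives `1 + (LL - log log 2) ≤ 3 LL`, the source of the factor `3` in the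
  -- constant.
  have hl2 : -1 ≤ Real.log (Real.log 2) := by
    rw [Real.le_log_iff_exp_le (Real.log_pos (by norm_num))]
    have h1 := Real.exp_neg_one_lt_d9
    have h2 := Real.log_two_gt_d9
    linarith
  set LL := Real.log (Real.log N)
  have hl := abs_nonneg l
  have key : A₂ + A₂ * |l| * (1 + (LL - Real.log (Real.log 2))) + A₁ + |l|
      ≤ (A₁ + A₂ * 3 + 1) * ((1 + |l|) * LL) := by
    have h6 : 1 + (LL - Real.log (Real.log 2)) ≤ 3 * LL := by linarith
    have h7 := mul_le_mul_of_nonneg_left h6 (mul_nonneg hA₂ hl)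
    have h8 := mul_le_mul_of_nonneg_left hLL hA₁
    have h9 := mul_le_mul_of_nonneg_left hLL hA₂
    have h10 := mul_le_mul_of_nonneg_left hLL hl
    have h11 : 0 ≤ A₁ * (|l| * LL) := by positivity
    have h12 : 0 ≤ A₂ * LL := by positivity
    nlinarith
  calc _ = (A₂ + A₂ * |l| * (1 + (LL - Real.log (Real.log 2))) + A₁ + |l|) / Real.log N := by
        ring
    _ ≤ ((A₁ + A₂ * 3 + 1) * ((1 + |l|) * LL)) / Real.log N :=
        div_le_div_of_nonneg_right key hL.le
    _ = _ := by ring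

/-! ### Logarithms of the local factors -/

/-- The second-order part of `log (1 + x + ⋯ + x ^ (k - 1))` for `‖x‖ < 1`. -/
noncomputable def logGeomRemainder (k : ℕ) (x : ℂ) : ℂ :=
  Complex.log (1 - x ^ k) - Complex.log (1 - x) - x

theorem one_sub_mem_slitPlane {x : ℂ} (hx : ‖x‖ < 1) : 1 - x ∈ Complex.slitPlane := by
  rw [sub_eq_add_neg]
  exact Complex.mem_slitPlane_of_norm_lt_one (by rwa [norm_neg])

theorem norm_pow_lt_one {x : ℂ} {k : ℕ} (hk : 2 ≤ k) (hx : ‖x‖ < 1) : ‖x ^ k‖ < 1 := by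
  rw [norm_pow]
  exact pow_lt_one₀ (norm_nonneg _) hx (by omega)

/-- The sum is `(1 - x ^ k) / (1 - x)`. Numerator and denominator are exponentiated separately, so
no additivity of the principal logarithm is needed. -/
theorem geom_sum_eq_exp {k : ℕ} (hk : 2 ≤ k) {x : ℂ} (hx : ‖x‖ < 1) :
    ∑ j ∈ Finset.range k, x ^ j = Complex.exp (x + logGeomRemainder k x) := by
  have h1 := Complex.slitPlane_ne_zero (one_sub_mem_slitPlane hx)
  have h2 := Complex.slitPlane_ne_zero (one_sub_mem_slitPlane (norm_pow_lt_one hk hx))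
  rw [logGeomRemainder, add_sub_cancel, Complex.exp_sub, Complex.exp_log h1, Complex.exp_log h2,
    eq_div_iff h1]
  have := geom_sum_mul_neg x k
  exact this

theorem logGeomRemainder_zero {k : ℕ} (hk : 2 ≤ k) : logGeomRemainder k 0 = 0 := by
  simp [logGeomRemainder, show k ≠ 0 by omega]

/-- The derivative is `z / (1 - z) - k z ^ (k - 1) / (1 - z ^ k)`, which is `O(|z|)` because `k ≥
2`. The factor `r` in the Lipschitz constant makes the remainder quadratic at `0`, and also controls
its change with the twist. -/
theorem logGeomRemainder_lipschitz {k : ℕ} (hk : 2 ≤ k) {ρ : ℝ} (hρ : ρ < 1) :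
    ∃ K : ℝ, 0 ≤ K ∧ ∀ r ≤ ρ, ∀ x y : ℂ, ‖x‖ ≤ r → ‖y‖ ≤ r →
      ‖logGeomRemainder k x - logGeomRemainder k y‖ ≤ K * r * ‖x - y‖ := by
  have hρ' : 0 < 1 - ρ := by linarith
  refine ⟨(k + 1) / (1 - ρ), by positivity, fun r hr x y hx hy => ?_⟩
  have hd : ∀ z ∈ Metric.closedBall (0 : ℂ) r, HasDerivWithinAt (logGeomRemainder k)
      (-(k * z ^ (k - 1)) / (1 - z ^ k) - (-1) / (1 - z) - 1) (Metric.closedBall 0 r) z := by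
    intro z hz
    have hz1 : ‖z‖ < 1 := by rw [mem_closedBall_zero_iff] at hz; linarith
    have d1 := ((hasDerivAt_pow k z).const_sub 1).clog
      (one_sub_mem_slitPlane (norm_pow_lt_one hk hz1))
    have d2 := ((hasDerivAt_id z).const_sub 1).clog (one_sub_mem_slitPlane hz1)
    exact ((d1.sub d2).sub (hasDerivAt_id z)).hasDerivWithinAt
  refine (convex_closedBall (0 : ℂ) r).norm_image_sub_le_of_norm_hasDerivWithin_le hd
    (fun z hz => ?_) (mem_closedBall_zero_iff.mpr hy) (mem_closedBall_zero_iff.mpr hx)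
  rw [mem_closedBall_zero_iff] at hz
  have hz0 := norm_nonneg z
  have hz1 : ‖z‖ < 1 := by linarith
  have h1 := Complex.slitPlane_ne_zero (one_sub_mem_slitPlane hz1)
  have n1 : 1 - ρ ≤ ‖1 - z‖ := by
    have := norm_sub_norm_le (1 : ℂ) z
    rw [norm_one] at this; linarith
  have hpow : ‖z‖ ^ k ≤ ‖z‖ := pow_le_of_le_one hz0 hz1.le (by omega)
  have hpow' : ‖z‖ ^ (k - 1) ≤ ‖z‖ := pow_le_of_le_one hz0 hz1.le (by omega)
  have n2 : 1 - ρ ≤ ‖1 - z ^ k‖ := by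
    have := norm_sub_norm_le (1 : ℂ) (z ^ k)
    rw [norm_one, norm_pow] at this; linarith
  have hrw : -(k * z ^ (k - 1)) / (1 - z ^ k) - (-1) / (1 - z) - 1
      = z / (1 - z) - k * z ^ (k - 1) / (1 - z ^ k) := by
    have : (-1 : ℂ) / (1 - z) + 1 = -(z / (1 - z)) := by
      field_simp; ring
    linear_combination -this
  rw [hrw]
  calc _ ≤ ‖z / (1 - z)‖ + ‖k * z ^ (k - 1) / (1 - z ^ k)‖ := norm_sub_le _ _
    _ ≤ r / (1 - ρ) + k * r / (1 - ρ) := by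
        rw [norm_div, norm_div, norm_mul, norm_pow, Complex.norm_natCast]
        refine add_le_add (div_le_div₀ (hz0.trans hz) hz hρ' n1) (div_le_div₀ ?_ ?_ hρ' n2)
        · exact mul_nonneg (Nat.cast_nonneg _) (hz0.trans hz)
        · exact mul_le_mul_of_nonneg_left (hpow'.trans hz) (Nat.cast_nonneg _)
    _ = _ := by ring

/-! ### The Euler product and the uniform asymptotics -/

/-- The sum of `α ^ Ω(n) n^{-1 + i t}` over the `k`-free integers with prime factors at most
`N`. -/
noncomputable def twistedSmoothSum (k : ℕ) (α : ℂ) (N : ℕ) (t : ℝ) : ℂ :=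
  ∑ n ∈ (kFreeSmooth_finite k N).toFinset,
    α ^ ArithmeticFunction.cardFactors n / (n : ℂ)
      * Complex.exp (Complex.I * t * (Real.log n : ℝ))

/-- The variable `α p^{-1 + i t}` of the local factor at the prime `p`. -/
noncomputable def localVar (α : ℂ) (t : ℝ) (p : ℕ) : ℂ :=
  α / p * Complex.exp (Complex.I * t * (Real.log p : ℝ))

theorem kFree_prime_pow_iff {k p e : ℕ} (hp : p.Prime) : KFree k (p ^ e) ↔ e < k := by
  constructor
  · intro h
    by_contra hle
    exact h p hp (pow_dvd_pow p (not_lt.mp hle))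
  · intro h q hq hdvd
    have hk : k ≠ 0 := by omega
    have hqp : q = p := (Nat.prime_dvd_prime_iff_eq hq hp).mp
      (hq.dvd_of_dvd_pow ((dvd_pow_self q hk).trans hdvd))
    subst hqp
    have := (Nat.pow_dvd_pow_iff_le_right hq.one_lt).mp hdvd
    omega

theorem kFree_mul_iff {k m n : ℕ} (hk : k ≠ 0) (h : m.Coprime n) :
    KFree k (m * n) ↔ KFree k m ∧ KFree k n := by
  unfold KFree
  constructor
  · intro H
    exact ⟨fun p hp hd => H p hp (hd.mul_right n), fun p hp hd => H p hp (hd.mul_left m)⟩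
  · rintro ⟨h1, h2⟩ p hp hd
    rcases (h.isPrimePow_dvd_mul (hp.isPrimePow.pow hk)).mp hd with h' | h'
    · exact h1 p hp h'
    · exact h2 p hp h'

theorem twistedSmoothSum_eq_prod {k : ℕ} (hk : 2 ≤ k) (α : ℂ) (N : ℕ) (t : ℝ) :
    twistedSmoothSum k α N t =
      ∏ p ∈ N.primesLE, ∑ j ∈ Finset.range k, localVar α t p ^ j := by
  classical
  set F : ℕ → ℂ := fun n => α ^ ArithmeticFunction.cardFactors n / (n : ℂ)
      * Complex.exp (Complex.I * t * (Real.log n : ℝ)) with hF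
  -- Extension by zero off the `k`-free integers keeps multiplicativity and cuts the local series at
  -- exponent `k`. The smoothness index `N + 1` allows prime factors up to and including `N`.
  set f : ℕ → ℂ := fun n => if KFree k n then F n else 0 with hf
  have hf0 : f 0 = 0 := by
    have : ¬ KFree k 0 := fun h => h 2 Nat.prime_two (dvd_zero _)
    simp [hf, this]
  have hf1 : f 1 = 1 := by
    have : KFree k 1 := by
      have := (kFree_prime_pow_iff (k := k) (e := 0) Nat.prime_two).mpr (by omega)
      simpa using this
    simp [hf, hF, this]
  have hmul : ∀ {m n : ℕ}, m.Coprime n → f (m * n) = f m * f n := by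
    intro m n hmn
    rcases eq_or_ne m 0 with rfl | hm
    · rw [zero_mul, hf0, zero_mul]
    rcases eq_or_ne n 0 with rfl | hn
    · rw [mul_zero, hf0, mul_zero]
    have hFm : F (m * n) = F m * F n := by
      have hm' : (m : ℝ) ≠ 0 := by exact_mod_cast hm
      have hn' : (n : ℝ) ≠ 0 := by exact_mod_cast hn
      simp only [hF]
      rw [ArithmeticFunction.cardFactors_mul hm hn, Nat.cast_mul, Nat.cast_mul,
        Real.log_mul hm' hn', Complex.ofReal_add, mul_add, Complex.exp_add, pow_add,
        mul_div_mul_comm]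
      ring
    simp only [hf]
    rw [kFree_mul_iff (by omega) hmn, hFm]
    by_cases h1 : KFree k m <;> by_cases h2 : KFree k n <;> simp [h1, h2]
  have hpow : ∀ {p : ℕ}, p.Prime → ∀ e : ℕ, f (p ^ e) = if e < k then localVar α t p ^ e else 0 := by
    intro p hp e
    simp only [hf]
    rw [kFree_prime_pow_iff hp]
    congr 1
    simp only [hF, localVar]
    rw [ArithmeticFunction.cardFactors_apply_prime_pow hp, Nat.cast_pow, Nat.cast_pow,
      Real.log_pow, mul_pow, div_pow, ← Complex.exp_nat_mul]
    congr 2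
    push_cast
    ring
  have hsum : ∀ {p : ℕ}, p.Prime → Summable (fun n : ℕ => ‖f (p ^ n)‖) := by
    intro p hp
    refine summable_of_ne_finset_zero (s := Finset.range k) fun e he => ?_
    rw [hpow hp, if_neg (by simpa using he), norm_zero]
  have h := (EulerProduct.summable_and_hasSum_smoothNumbers_prod_primesBelow_tsum hf1 hmul hsum
    (N + 1)).2.tsum_eq
  have hprod : ∏ p ∈ (N + 1).primesBelow, ∑' n : ℕ, f (p ^ n)
      = ∏ p ∈ N.primesLE, ∑ j ∈ Finset.range k, localVar α t p ^ j := by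
    refine Finset.prod_congr rfl fun p hp => ?_
    have hpp := (Nat.mem_primesBelow.mp hp).2
    rw [tsum_eq_sum (s := Finset.range k)]
    · exact Finset.sum_congr rfl fun j hj => by
        rw [hpow hpp, if_pos (by simpa using hj)]
    · intro e he
      rw [hpow hpp, if_neg (by simpa using he)]
  rw [← hprod, ← h, tsum_subtype (Nat.smoothNumbers (N + 1)) f,
    tsum_eq_sum (s := (kFreeSmooth_finite k N).toFinset)]
  · refine Finset.sum_congr rfl fun n hn => ?_
    obtain ⟨hn0, hkn, hsm⟩ := (kFreeSmooth_finite k N).mem_toFinset.mp hn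
    rw [Set.indicator_of_mem]
    · simp only [hf, if_pos hkn]
      rfl
    · exact Nat.mem_smoothNumbers'.mpr fun p hp hd => Nat.lt_succ_of_le (hsm p hp hd)
  · intro n hn
    by_cases hs : n ∈ Nat.smoothNumbers (N + 1)
    · rw [Set.indicator_of_mem hs]
      by_cases hkn : KFree k n
      · exfalso
        refine hn ((kFreeSmooth_finite k N).mem_toFinset.mpr ⟨?_, hkn, fun p hp hd => ?_⟩)
        · exact Nat.pos_of_ne_zero (Nat.mem_smoothNumbers.mp hs).1
        · exact Nat.le_of_lt_succ (Nat.mem_smoothNumbers'.mp hs p hp hd)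
      · simp only [hf, if_neg hkn]
    · rw [Set.indicator_of_notMem hs]

theorem norm_localVar (α : ℂ) (t : ℝ) (p : ℕ) : ‖localVar α t p‖ = ‖α‖ / p := by
  rw [localVar, norm_mul, norm_exp_I_mul_mul, norm_div, Complex.norm_natCast, mul_one]

theorem localVar_zero (α : ℂ) (p : ℕ) : localVar α 0 p = α / p := by
  simp [localVar]

theorem norm_localVar_sub_le (α : ℂ) (t : ℝ) (p : ℕ) :
    ‖localVar α t p - localVar α 0 p‖ ≤ ‖α‖ / p * (|t| * Real.log p) := by
  rw [localVar_zero, localVar, ← mul_sub_one, norm_mul, norm_div, Complex.norm_natCast]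
  refine mul_le_mul_of_nonneg_left ?_ (by positivity)
  have := norm_exp_I_mul_sub_one_le t (Real.log p)
  rwa [abs_of_nonneg (Real.log_natCast_nonneg p)] at this

/-- The second-order contribution of the primes, uniformly in the twist. -/
theorem sum_logGeomRemainder_asymptotic {k : ℕ} (hk : 2 ≤ k) {α : ℂ} (hα : ‖α‖ < 2) :
    ∃ (G : ℂ) (A : ℝ), 0 ≤ A ∧ ∀ N : ℕ, 2 ≤ N → ∀ t : ℝ,
      ‖∑ p ∈ N.primesLE, logGeomRemainder k (localVar α t p) - G‖
        ≤ A * (|t| + 1 / Real.log N) := by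
  classical
  -- All local variables have norm `|α| / p ≤ |α| / 2 < 1`.
  obtain ⟨K, hK0, hK⟩ := logGeomRemainder_lipschitz hk (ρ := ‖α‖ / 2) (by linarith)
  set w : ℕ → ℝ := fun n => Real.log n / ((n : ℝ) * (n - 1)) with hw
  have hw0 : ∀ n, 0 ≤ w n := by
    intro n
    rcases Nat.eq_zero_or_pos n with rfl | hn
    · simp [hw]
    have hn' : (1 : ℝ) ≤ n := by exact_mod_cast hn
    exact div_nonneg (Real.log_nonneg hn') (mul_nonneg (by positivity) (by linarith))
  have hws : Summable w := summable_log_div_mul_pred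
  set S := ∑' n, w n with hS
  have hS0 : 0 ≤ S := tsum_nonneg hw0
  set g : ℕ → ℂ := fun p => if p.Prime then logGeomRemainder k (localVar α 0 p) else 0 with hg
  have hrad : ∀ p : ℕ, p.Prime → ‖α‖ / p ≤ ‖α‖ / 2 := fun p hp =>
    div_le_div_of_nonneg_left (norm_nonneg _) (by norm_num) (by exact_mod_cast hp.two_le)
  have hsq : ∀ p : ℕ, p.Prime → Real.log p / (p : ℝ) ^ 2 ≤ w p := fun p hp => by
    have h1 : (1 : ℝ) < p := by exact_mod_cast hp.one_lt
    exact div_le_div_of_nonneg_left (Real.log_nonneg h1.le)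
      (mul_pos (by linarith) (by linarith)) (by nlinarith)
  -- For `p ≥ N`, `1 / p ^ 2 ≤ (log p / p ^ 2) / log N`; this produces the factor `1 / log N` in the
  -- tail.
  have hgb : ∀ N : ℕ, 2 ≤ N → ∀ p : ℕ, N ≤ p → ‖g p‖ ≤ K * ‖α‖ ^ 2 / Real.log N * w p := by
    intro N hN p hNp
    have hN2 : (2 : ℝ) ≤ N := by exact_mod_cast hN
    have hL : 0 < Real.log N := Real.log_pos (by linarith)
    by_cases hp : p.Prime
    · have h := hK _ (hrad p hp) (localVar α 0 p) 0 (norm_localVar α 0 p).le (by simp; positivity)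
      rw [logGeomRemainder_zero hk, sub_zero, sub_zero, norm_localVar] at h
      simp only [hg, if_pos hp]
      have hlog : Real.log N ≤ Real.log p :=
        Real.log_le_log (by linarith) (by exact_mod_cast hNp)
      have h2 := hsq p hp
      have h0 : (0 : ℝ) < p := by exact_mod_cast hp.pos
      calc _ ≤ K * ‖α‖ ^ 2 * (1 / (p : ℝ) ^ 2) := by
            refine h.trans (le_of_eq ?_)
            field_simp
        _ ≤ K * ‖α‖ ^ 2 * (w p / Real.log N) := by
            refine mul_le_mul_of_nonneg_left ?_ (by positivity)
            rw [le_div_iff₀ hL]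
            refine le_trans ?_ h2
            rw [one_div, inv_mul_eq_div]
            exact div_le_div_of_nonneg_right hlog (by positivity)
        _ = _ := by ring
    · simp only [hg, if_neg hp, norm_zero]
      exact mul_nonneg (by positivity) (hw0 p)
  have hgs : Summable g := by
    refine (summable_nat_add_iff 2).mp ?_
    refine Summable.of_norm_bounded
      (g := fun n => K * ‖α‖ ^ 2 / Real.log (2 : ℕ) * w (n + 2)) ?_ fun n => ?_
    · exact ((summable_nat_add_iff 2).mpr hws).mul_left _
    · exact hgb 2 le_rfl _ (by omega)
  refine ⟨∑' p, g p, K * ‖α‖ ^ 2 * S, by positivity, fun N hN t => ?_⟩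
  have hN2 : (2 : ℝ) ≤ N := by exact_mod_cast hN
  have hL : 0 < Real.log N := Real.log_pos (by linarith)
  have hpart : ∑ p ∈ N.primesLE, logGeomRemainder k (localVar α 0 p)
      = ∑ p ∈ Finset.range (N + 1), g p := by
    rw [Nat.primesLE, Nat.primesBelow, Finset.sum_filter]
  have htail : ‖∑ p ∈ Finset.range (N + 1), g p - ∑' p, g p‖ ≤ K * ‖α‖ ^ 2 * S / Real.log N := by
    rw [← hgs.sum_add_tsum_nat_add (N + 1), sub_add_cancel_left, norm_neg]
    have hs' : Summable fun n => K * ‖α‖ ^ 2 / Real.log N * w (n + (N + 1)) :=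
      ((summable_nat_add_iff (N + 1)).mpr hws).mul_left _
    refine (tsum_of_norm_bounded hs'.hasSum fun n => hgb N hN _ (by omega)).trans ?_
    rw [tsum_mul_left]
    have h3 : ∑' n, w (n + (N + 1)) ≤ S := by
      rw [hS, ← hws.sum_add_tsum_nat_add (N + 1)]
      exact le_add_of_nonneg_left (Finset.sum_nonneg fun n _ => hw0 n)
    calc _ ≤ K * ‖α‖ ^ 2 / Real.log N * S := mul_le_mul_of_nonneg_left h3 (by positivity)
      _ = _ := by ring
  have hmove : ‖∑ p ∈ N.primesLE, logGeomRemainder k (localVar α t p)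
      - ∑ p ∈ N.primesLE, logGeomRemainder k (localVar α 0 p)‖ ≤ K * ‖α‖ ^ 2 * S * |t| := by
    rw [← Finset.sum_sub_distrib]
    calc _ ≤ ∑ p ∈ N.primesLE, K * ‖α‖ ^ 2 * |t| * w p := by
          refine norm_sum_le_of_le _ fun p hp => ?_
          have hp := (Nat.mem_primesLE.mp hp).2
          have h := hK _ (hrad p hp) (localVar α t p) (localVar α 0 p) (norm_localVar α t p).le
            (norm_localVar α 0 p).le
          have h0 : (0 : ℝ) < p := by exact_mod_cast hp.pos
          calc _ ≤ K * (‖α‖ / p) * (‖α‖ / p * (|t| * Real.log p)) :=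
                h.trans (mul_le_mul_of_nonneg_left (norm_localVar_sub_le α t p) (by positivity))
            _ = K * ‖α‖ ^ 2 * |t| * (Real.log p / (p : ℝ) ^ 2) := by field_simp
            _ ≤ _ := mul_le_mul_of_nonneg_left (hsq p hp) (by positivity)
      _ ≤ K * ‖α‖ ^ 2 * |t| * S := by
          rw [← Finset.mul_sum]
          exact mul_le_mul_of_nonneg_left (hws.sum_le_tsum _ fun n _ => hw0 n) (by positivity)
      _ = _ := by ring
  rw [← hpart] at htail
  calc _ ≤ _ := norm_sub_le_norm_sub_add_norm_sub _
          (∑ p ∈ N.primesLE, logGeomRemainder k (localVar α 0 p)) _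
    _ ≤ K * ‖α‖ ^ 2 * S * |t| + K * ‖α‖ ^ 2 * S / Real.log N := add_le_add hmove htail
    _ = _ := by ring

/-- Uniform asymptotics of the twisted sums, in multiplicative form. -/
theorem twistedSmoothSum_asymptotic {k : ℕ} (hk : 2 ≤ k) {α : ℂ} (hα : ‖α‖ < 2) :
    ∃ (C : ℂ) (A : ℝ), C ≠ 0 ∧ 0 ≤ A ∧ ∀ᶠ N : ℕ in atTop, ∀ l : ℝ, ∃ z : ℂ,
      ‖z‖ ≤ A * ((1 + |l|) * (Real.log (Real.log N) / Real.log N)) ∧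
      twistedSmoothSum k α N (l / Real.log N) =
        C * (Real.log N : ℂ) ^ α * (phi α l * Complex.exp z) := by
  obtain ⟨M, A₁, hA₁, h₁⟩ := sum_primes_exp_div_asymptotic
  obtain ⟨G, A₂, hA₂, h₂⟩ := sum_logGeomRemainder_asymptotic hk hα
  -- `M` is the Mertens constant and `G` the full sum of remainders; `α log log N` becomes the power
  -- `(log N) ^ α`.
  refine ⟨Complex.exp (α * M + G), ‖α‖ * A₁ + A₂, Complex.exp_ne_zero _, by positivity, ?_⟩
  have hLL : ∀ᶠ N : ℕ in atTop, 1 ≤ Real.log (Real.log N) :=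
    (Real.tendsto_log_atTop.comp
      (Real.tendsto_log_atTop.comp tendsto_natCast_atTop_atTop)).eventually_ge_atTop 1
  filter_upwards [h₁, hLL, eventually_ge_atTop 2] with N h₁ hLL hN l
  have hN2 : (2 : ℝ) ≤ N := by exact_mod_cast hN
  have hL : 0 < Real.log N := Real.log_pos (by linarith)
  have e1 := h₁ l
  have e2 := h₂ N hN (l / Real.log N)
  set L := Real.log N with hLdef
  set P := ∑ p ∈ N.primesLE, Complex.exp (Complex.I * (l / L : ℝ) * (Real.log p : ℝ)) / p
  set Q := ∑ p ∈ N.primesLE, logGeomRemainder k (localVar α (l / L) p)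
  refine ⟨α * (P - ((Real.log L + M : ℝ) + oscIntegral l)) + (Q - G), ?_, ?_⟩
  · refine (norm_add_le _ _).trans ?_
    rw [norm_mul]
    have e3 : |l / L| + 1 / L ≤ (1 + |l|) * (Real.log L / L) := by
      rw [abs_div, abs_of_pos hL, ← add_div, ← mul_div_assoc]
      exact div_le_div_of_nonneg_right (by nlinarith [abs_nonneg l]) hL.le
    calc _ ≤ ‖α‖ * (A₁ * ((1 + |l|) * (Real.log L / L)))
          + A₂ * ((1 + |l|) * (Real.log L / L)) :=
        add_le_add (mul_le_mul_of_nonneg_left e1 (norm_nonneg _))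
          (e2.trans (mul_le_mul_of_nonneg_left e3 hA₂))
      _ = _ := by ring
  · have hprod : twistedSmoothSum k α N (l / L) = Complex.exp (α * P + Q) := by
      rw [twistedSmoothSum_eq_prod hk, Finset.mul_sum, ← Finset.sum_add_distrib, Complex.exp_sum]
      refine Finset.prod_congr rfl fun p hp => ?_
      have hp := (Nat.mem_primesLE.mp hp).2
      have hlt : ‖localVar α (l / L) p‖ < 1 := by
        rw [norm_localVar, div_lt_one (by exact_mod_cast hp.pos)]
        have : (2 : ℝ) ≤ p := by exact_mod_cast hp.two_le
        linarith
      rw [geom_sum_eq_exp hk hlt]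
      congr 2
      rw [localVar]
      ring
    have hphi : phi α l = Complex.exp (α * oscIntegral l) := rfl
    have hL0 : (L : ℂ) ≠ 0 := by exact_mod_cast hL.ne'
    rw [hprod, hphi, Complex.cpow_def_of_ne_zero hL0, ← Complex.ofReal_log hL.le,
      ← Complex.exp_add, ← Complex.exp_add, ← Complex.exp_add]
    congr 1
    push_cast
    ring

/-! ### The size of `phi` and of the twisted sums -/

theorem continuous_oscIntegral : Continuous oscIntegral := by
  refine LipschitzWith.continuous (K := 1) (LipschitzWith.of_dist_le_mul fun l m => ?_)
  rw [NNReal.coe_one, one_mul, dist_eq_norm, Real.dist_eq, oscIntegral, oscIntegral,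
    ← intervalIntegral.integral_sub (intervalIntegrable_exp_sub_one_div l 0 1)
      (intervalIntegrable_exp_sub_one_div m 0 1)]
  refine (intervalIntegral.norm_integral_le_of_norm_le_const (C := |l - m|) fun v _ => ?_).trans
    (by norm_num)
  have h : (Complex.exp (Complex.I * l * v) - 1) / (v : ℂ)
      - (Complex.exp (Complex.I * m * v) - 1) / (v : ℂ)
      = Complex.exp (Complex.I * m * v)
        * ((Complex.exp (Complex.I * (l - m : ℝ) * v) - 1) / (v : ℂ)) := by
    have : Complex.exp (Complex.I * l * v)
        = Complex.exp (Complex.I * m * v) * Complex.exp (Complex.I * (l - m : ℝ) * v) := by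
      rw [← Complex.exp_add]
      congr 1
      push_cast
      ring
    rw [this]
    ring
  rw [h, norm_mul, norm_exp_I_mul_mul, one_mul]
  exact norm_exp_I_mul_sub_one_div_le _ _

theorem continuous_phi (α : ℂ) : Continuous (phi α) :=
  (continuous_const.mul continuous_oscIntegral).cexp

/-- Integration by parts against `1 / v`: the two boundary terms and the remaining integral are each
at most `1`. -/
theorem norm_integral_exp_div_le {l : ℝ} (hl : 1 ≤ |l|) :
    ‖∫ v in (|l|⁻¹)..1, Complex.exp (Complex.I * l * v) / (v : ℂ)‖ ≤ 3 := by
  have hl0 : 0 < |l| := by linarith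
  have hle : |l|⁻¹ ≤ 1 := inv_le_one_of_one_le₀ hl
  have hpos : ∀ v ∈ Set.uIcc |l|⁻¹ 1, 0 < v := fun v hv => by
    rw [Set.uIcc_of_le hle] at hv
    exact lt_of_lt_of_le (by positivity) hv.1
  have hlc : (Complex.I * l) ≠ 0 :=
    mul_ne_zero Complex.I_ne_zero (by exact_mod_cast abs_pos.mp hl0)
  have hnl : ‖Complex.I * (l : ℂ)‖ = |l| := by
    rw [norm_mul, Complex.norm_I, one_mul, Complex.norm_real, Real.norm_eq_abs]
  have hu : ∀ v ∈ Set.uIcc |l|⁻¹ 1,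
      HasDerivAt (fun v : ℝ => ((v⁻¹ : ℝ) : ℂ)) ((-(v ^ 2)⁻¹ : ℝ) : ℂ) v := fun v hv =>
    (hasDerivAt_inv (hpos v hv).ne').ofReal_comp
  have hv : ∀ v ∈ Set.uIcc |l|⁻¹ 1,
      HasDerivAt (fun v : ℝ => Complex.exp (Complex.I * l * v) / (Complex.I * l))
        (Complex.exp (Complex.I * l * v)) v := fun v _ => by
    have h1 : HasDerivAt (fun v : ℝ => Complex.I * l * (v : ℂ)) (Complex.I * l * 1) v :=
      (Complex.ofRealCLM.hasDerivAt (x := v)).const_mul (Complex.I * l)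
    exact (h1.cexp.div_const (Complex.I * l)).congr_deriv
      (by rw [mul_one, mul_div_assoc, div_self hlc, mul_one])
  have hc1 : ContinuousOn (fun v : ℝ => ((-(v ^ 2)⁻¹ : ℝ) : ℂ)) (Set.uIcc |l|⁻¹ 1) :=
    Complex.continuous_ofReal.comp_continuousOn
      ((continuousOn_id.pow 2).inv₀ fun v hv => pow_ne_zero 2 (hpos v hv).ne').neg
  have hparts := intervalIntegral.integral_mul_deriv_eq_deriv_mul hu hv hc1.intervalIntegrable
    (Continuous.intervalIntegrable (by fun_prop) _ _)
  have heq : ∫ v in (|l|⁻¹)..1, Complex.exp (Complex.I * l * v) / (v : ℂ)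
      = ∫ v in (|l|⁻¹)..1, ((v⁻¹ : ℝ) : ℂ) * Complex.exp (Complex.I * l * v) := by
    refine intervalIntegral.integral_congr fun v _ => ?_
    push_cast
    ring
  have hE : ∀ v : ℝ, ‖Complex.exp (Complex.I * l * v) / (Complex.I * l)‖ = |l|⁻¹ := fun v => by
    rw [norm_div, norm_exp_I_mul_mul, hnl, one_div]
  have hint : ‖∫ v in (|l|⁻¹)..1, ((-(v ^ 2)⁻¹ : ℝ) : ℂ)
      * (Complex.exp (Complex.I * l * v) / (Complex.I * l))‖ ≤ 1 := by
    have hFTC : ∫ v in (|l|⁻¹)..1, (v ^ 2)⁻¹ * |l|⁻¹ = 1 - |l|⁻¹ := by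
      rw [intervalIntegral.integral_mul_const]
      have : ∫ v in (|l|⁻¹)..1, (v ^ 2)⁻¹ = -(1 : ℝ)⁻¹ - -(|l|⁻¹)⁻¹ := by
        refine intervalIntegral.integral_eq_sub_of_hasDerivAt (f := fun v => -v⁻¹)
          (fun v hv => ?_) ?_
        · exact (hasDerivAt_inv (hpos v hv).ne').neg.congr_deriv (by ring)
        · exact ((continuousOn_id.pow 2).inv₀ fun v hv =>
            pow_ne_zero 2 (hpos v hv).ne').intervalIntegrable
      rw [this, inv_inv, inv_one]
      field_simp
      ring
    have h := intervalIntegral.norm_integral_le_of_norm_le (μ := volume)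
      (f := fun v : ℝ => ((-(v ^ 2)⁻¹ : ℝ) : ℂ)
        * (Complex.exp (Complex.I * l * v) / (Complex.I * l)))
      (g := fun v : ℝ => (v ^ 2)⁻¹ * |l|⁻¹) hle (Eventually.of_forall fun v _ => by
        rw [norm_mul, hE, Complex.norm_real, norm_neg, Real.norm_of_nonneg (by positivity)])
      (ContinuousOn.intervalIntegrable (((continuousOn_id.pow 2).inv₀ fun v hv =>
        pow_ne_zero 2 (hpos v hv).ne').mul continuousOn_const))
    rw [hFTC] at h
    have : 0 ≤ |l|⁻¹ := by positivity
    linarith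
  rw [heq, hparts]
  refine (norm_sub_le _ _).trans ?_
  refine (add_le_add (norm_sub_le _ _) hint).trans ?_
  rw [norm_mul, norm_mul, hE, hE, Complex.norm_real, Complex.norm_real, inv_one, norm_one,
    inv_inv, Real.norm_of_nonneg hl0.le, mul_inv_cancel₀ hl0.ne']
  linarith

/-- The exponent of `phi` agrees with `-log (1 + |l|)` up to a bounded error. -/
theorem norm_oscIntegral_add_log_le (l : ℝ) :
    ‖oscIntegral l + (Real.log (1 + |l|) : ℝ)‖ ≤ 5 := by
  have hlog2 : Real.log 2 ≤ 1 := by linarith [Real.log_two_lt_d9]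
  have hl0 := abs_nonneg l
  -- For `|l| ≥ 1` the integral is cut at `1 / |l|`. Below the cut it is at most `1`; above it the
  -- oscillating part is at most `3`, and `-1 / v` contributes `-log |l|`, within `1` of `-log (1 +
  -- |l|)`.
  rcases le_total |l| 1 with hl | hl
  · have h1 : ‖oscIntegral l‖ ≤ |l| := by
      have := intervalIntegral.norm_integral_le_of_norm_le_const (a := 0) (b := 1) (C := |l|)
        fun v _ => norm_exp_I_mul_sub_one_div_le l v
      simpa [oscIntegral] using this
    have h2 : ‖((Real.log (1 + |l|) : ℝ) : ℂ)‖ ≤ 1 := by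
      rw [Complex.norm_real, Real.norm_of_nonneg (Real.log_nonneg (by linarith))]
      exact (Real.log_le_log (by linarith) (by linarith)).trans hlog2
    linarith [norm_add_le (oscIntegral l) ((Real.log (1 + |l|) : ℝ) : ℂ)]
  · have hlp : 0 < |l| := by linarith
    have hle : |l|⁻¹ ≤ 1 := inv_le_one_of_one_le₀ hl
    have hpos : ∀ v ∈ Set.uIcc |l|⁻¹ 1, 0 < v := fun v hv => by
      rw [Set.uIcc_of_le hle] at hv
      exact lt_of_lt_of_le (by positivity) hv.1
    have hne : ∀ v ∈ Set.uIcc |l|⁻¹ 1, (v : ℂ) ≠ 0 := fun v hv => by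
      exact_mod_cast (hpos v hv).ne'
    have hsplit : oscIntegral l
        = (∫ v in (0 : ℝ)..|l|⁻¹, (Complex.exp (Complex.I * l * v) - 1) / (v : ℂ))
          + ((∫ v in (|l|⁻¹)..1, Complex.exp (Complex.I * l * v) / (v : ℂ))
            - (Real.log |l| : ℝ)) := by
      rw [oscIntegral, ← intervalIntegral.integral_add_adjacent_intervals
        (intervalIntegrable_exp_sub_one_div l 0 |l|⁻¹)
        (intervalIntegrable_exp_sub_one_div l |l|⁻¹ 1)]
      congr 1
      have hlog : ((Real.log |l| : ℝ) : ℂ) = ∫ v in (|l|⁻¹)..1, (1 / v : ℂ) := by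
        have h1 : ∫ v in (|l|⁻¹)..1, (1 / v : ℝ) = Real.log |l| := by
          rw [integral_one_div_of_pos (by positivity) one_pos, one_div, inv_inv]
        rw [← h1, ← intervalIntegral.integral_ofReal]
        refine intervalIntegral.integral_congr fun v _ => ?_
        push_cast
        rfl
      rw [hlog, ← intervalIntegral.integral_sub]
      · refine intervalIntegral.integral_congr fun v _ => ?_
        ring
      · exact (ContinuousOn.div (by fun_prop) (by fun_prop) hne).intervalIntegrable
      · exact (ContinuousOn.div (by fun_prop) (by fun_prop) hne).intervalIntegrable
    have h1 : ‖∫ v in (0 : ℝ)..|l|⁻¹, (Complex.exp (Complex.I * l * v) - 1) / (v : ℂ)‖ ≤ 1 := by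
      have h := intervalIntegral.norm_integral_le_of_norm_le_const (a := 0) (b := |l|⁻¹)
        (C := |l|) fun v _ => norm_exp_I_mul_sub_one_div_le l v
      rwa [sub_zero, abs_inv, abs_abs, mul_inv_cancel₀ hlp.ne'] at h
    have h2 := norm_integral_exp_div_le hl
    have h3 : ‖((Real.log (1 + |l|) - Real.log |l| : ℝ) : ℂ)‖ ≤ 1 := by
      rw [Complex.norm_real, Real.norm_of_nonneg
        (sub_nonneg.mpr (Real.log_le_log hlp (by linarith)))]
      have h4 : Real.log (1 + |l|) ≤ Real.log (2 * |l|) :=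
        Real.log_le_log (by linarith) (by linarith)
      rw [Real.log_mul (by norm_num) hlp.ne'] at h4
      linarith
    have htri : ∀ a b c d : ℂ, a + (b - c) + d = a + (b + (d - c)) := by intros; ring
    rw [hsplit, htri, ← Complex.ofReal_sub]
    have h5 := norm_add_le (∫ v in (|l|⁻¹)..1, Complex.exp (Complex.I * l * v) / (v : ℂ))
      ((Real.log (1 + |l|) - Real.log |l| : ℝ) : ℂ)
    refine (norm_add_le _ _).trans ?_
    linarith

theorem norm_phi_le (α : ℂ) :
    ∃ K : ℝ, 0 ≤ K ∧ ∀ l : ℝ, ‖phi α l‖ ≤ K * (1 + |l|) ^ (-α.re) := by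
  refine ⟨Real.exp (‖α‖ * 5), (Real.exp_pos _).le, fun l => ?_⟩
  have hpos : 0 < 1 + |l| := by positivity
  have hphi : phi α l = Complex.exp (α * oscIntegral l) := rfl
  rw [hphi, Complex.norm_exp, Real.rpow_def_of_pos hpos, ← Real.exp_add, Real.exp_le_exp]
  have h1 : α * oscIntegral l = α * (oscIntegral l + (Real.log (1 + |l|) : ℝ))
      - α * (Real.log (1 + |l|) : ℝ) := by ring
  have h2 : (α * (oscIntegral l + (Real.log (1 + |l|) : ℝ))).re ≤ ‖α‖ * 5 := by
    refine (Complex.re_le_norm _).trans ?_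
    rw [norm_mul]
    exact mul_le_mul_of_nonneg_left (norm_oscIntegral_add_log_le l) (norm_nonneg _)
  rw [h1, Complex.sub_re, Complex.re_mul_ofReal]
  linarith

theorem phi_zero (α : ℂ) : phi α 0 = 1 := by
  simp [phi]

/-- A bound for the twisted sums that is uniform in the twist. -/
theorem norm_twistedSmoothSum_le {k : ℕ} (hk : 2 ≤ k) {α : ℂ} (hα : ‖α‖ < 2) :
    ∃ K : ℝ, 0 ≤ K ∧ ∀ᶠ N : ℕ in atTop, ∀ t : ℝ,
      ‖twistedSmoothSum k α N t‖ ≤ K * Real.log N ^ ‖α‖ := by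
  -- By the triangle inequality the sum is at most the one with `|α|` for `α` and no twist, to which
  -- the asymptotic formula at `l = 0` applies.
  have hα' : ‖((‖α‖ : ℝ) : ℂ)‖ < 2 := by rwa [Complex.norm_real, norm_norm]
  obtain ⟨C, A, -, hA, h⟩ := twistedSmoothSum_asymptotic hk hα'
  refine ⟨‖C‖ * Real.exp A, by positivity, ?_⟩
  filter_upwards [h, eventually_ge_atTop 2] with N h hN t
  have hL : 0 < Real.log N := Real.log_pos (by exact_mod_cast hN)
  obtain ⟨z, hz, hval⟩ := h 0
  have hzA : ‖z‖ ≤ A := by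
    refine hz.trans ?_
    have : Real.log (Real.log N) / Real.log N ≤ 1 :=
      (div_le_one hL).mpr ((Real.log_le_sub_one_of_pos hL).trans (by linarith))
    rw [abs_zero, add_zero, one_mul]
    nlinarith
  have htriv : ‖twistedSmoothSum k α N t‖ ≤ ‖twistedSmoothSum k (‖α‖ : ℝ) N 0‖ := by
    have heq : twistedSmoothSum k (‖α‖ : ℝ) N 0 = ((∑ n ∈ (kFreeSmooth_finite k N).toFinset,
        ‖α‖ ^ ArithmeticFunction.cardFactors n / (n : ℝ) : ℝ) : ℂ) := by
      simp [twistedSmoothSum]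
    rw [heq, Complex.norm_real, Real.norm_of_nonneg (Finset.sum_nonneg fun n _ => by positivity)]
    refine norm_sum_le_of_le _ fun n _ => ?_
    rw [norm_mul, norm_exp_I_mul_mul, norm_div, norm_pow, Complex.norm_natCast, mul_one]
  refine htriv.trans ?_
  rw [zero_div] at hval
  rw [hval, phi_zero, one_mul, norm_mul, norm_mul, Complex.norm_cpow_eq_rpow_re_of_pos hL,
    Complex.ofReal_re]
  have : ‖Complex.exp z‖ ≤ Real.exp A := by
    rw [Complex.norm_exp]
    exact Real.exp_le_exp.mpr ((Complex.re_le_norm z).trans hzA)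
  calc _ ≤ ‖C‖ * Real.log N ^ ‖α‖ * Real.exp A :=
        mul_le_mul_of_nonneg_left this (by positivity)
    _ = _ := by ring

/-! ### Fourier inversion -/

open FourierTransform in
/-- Fourier inversion for a continuous function with an integrable Fourier transform. -/
theorem IsFourierTransform.eq_integral {f g : ℝ → ℂ} (h : IsFourierTransform f g)
    (hf : Continuous f) (hg : Integrable g) (x : ℝ) :
    f x = ∫ t : ℝ, g t * Complex.exp (Complex.I * t * x) := by
  set F : ℝ → ℂ := fun x => ∫ t : ℝ, g t * Complex.exp (Complex.I * t * x) with hF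
  have hFc : Continuous F := by
    refine continuous_of_dominated (bound := fun t => ‖g t‖) (fun x => ?_) (fun x => ?_) hg.norm ?_
    · exact hg.aestronglyMeasurable.mul (Continuous.aestronglyMeasurable (by fun_prop))
    · refine Eventually.of_forall fun t => ?_
      rw [norm_mul, norm_exp_I_mul_mul, mul_one]
    · exact Eventually.of_forall fun t => by fun_prop
  have hae : ∀ᵐ y : ℝ, f y = F y := by
    refine ae_eq_of_integral_contDiff_smul_eq hf.locallyIntegrable hFc.locallyIntegrable
      fun u hu hus => ?_
    have hus' : HasCompactSupport (fun y => (u y : ℂ)) :=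
      hus.comp_left (g := fun r : ℝ => (r : ℂ)) Complex.ofReal_zero
    have hu' : ContDiff ℝ (⊤ : ℕ∞) (fun y => (u y : ℂ)) := Complex.ofRealCLM.contDiff.comp hu
    set U : 𝓢(ℝ, ℂ) := hus'.toSchwartzMap hu' with hU
    have hUapp : ∀ y, U y = (u y : ℂ) := fun y => rfl
    have hπ : (2 * Real.pi)⁻¹ ≠ 0 := inv_ne_zero (by positivity)
    -- The test function is `ψ t = ∫ u(y) e^{i t y} dy`, rescaled by `2π` from Mathlib's kernel. The
    -- right side of the defining identity becomes `∫ f u`, and Fubini turns the left side into `∫ F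
    -- u`.
    set ψ : 𝓢(ℝ, ℂ) := SchwartzMap.compCLMOfContinuousLinearEquiv ℂ
      (ContinuousLinearEquiv.smulLeft (Units.mk0 _ hπ) : ℝ ≃L[ℝ] ℝ) (𝓕⁻ U) with hψ
    have hψapp : ∀ t, ψ t = (𝓕⁻ U) (t / (2 * Real.pi)) := fun t => by
      have : ψ t = (𝓕⁻ U) ((2 * Real.pi)⁻¹ * t) := rfl
      rw [this]
      congr 1
      ring
    have hψint : ∀ t, ψ t = ∫ y : ℝ, Complex.exp (Complex.I * t * y) * (u y : ℂ) := fun t => by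
      rw [hψapp, SchwartzMap.fourierInv_coe, Real.fourierInv_eq']
      refine integral_congr_ae (Eventually.of_forall fun y => ?_)
      simp only [smul_eq_mul, hUapp, RCLike.inner_apply, conj_trivial]
      congr 2
      push_cast
      field_simp
    have hinv : ∀ y : ℝ, (2 * Real.pi : ℂ)⁻¹ * ∫ t : ℝ, Complex.exp (-(Complex.I * t * y)) * ψ t
        = u y := fun y => by
      have h1 : ∫ t : ℝ, Complex.exp (-(Complex.I * t * y)) * ψ t
          = |2 * Real.pi| • ∫ s : ℝ, Complex.exp (-(Complex.I * (2 * Real.pi * s : ℝ) * y))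
            * (𝓕⁻ U) s := by
        rw [← Measure.integral_comp_div]
        refine integral_congr_ae (Eventually.of_forall fun t => ?_)
        simp only [hψapp]
        congr 5
        have : Real.pi ≠ 0 := Real.pi_ne_zero
        field_simp
      have h2 : 𝓕 (𝓕⁻ U) y = U y := by rw [FourierTransform.fourier_fourierInv_eq]
      rw [SchwartzMap.fourier_coe, Real.fourier_real_eq_integral_exp_smul, hUapp] at h2
      rw [h1, ← h2, abs_of_pos (by positivity), Complex.real_smul, ← mul_assoc]
      have h3 : (2 * Real.pi : ℂ)⁻¹ * ((2 * Real.pi : ℝ) : ℂ) = 1 := by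
        push_cast
        exact inv_mul_cancel₀ (by simp [Real.pi_ne_zero])
      rw [h3, one_mul]
      refine integral_congr_ae (Eventually.of_forall fun s => ?_)
      simp only [smul_eq_mul]
      congr 2
      push_cast
      ring
    have hmain := (h.2 ψ).2
    simp only [hinv] at hmain
    have hleft : ∫ y, u y • f y = ∫ y, f y * (u y : ℂ) :=
      integral_congr_ae (Eventually.of_forall fun y => by
        simp only [Complex.real_smul]; ring)
    rw [hleft, ← hmain]
    simp only [hψint, ← integral_const_mul]
    have huint : Integrable (fun y => (u y : ℂ)) := hu'.continuous.integrable_of_hasCompactSupport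
      hus'
    rw [integral_integral_swap]
    · refine integral_congr_ae (Eventually.of_forall fun y => ?_)
      simp only [hF, Complex.real_smul, ← integral_const_mul]
      refine integral_congr_ae (Eventually.of_forall fun t => ?_)
      simp only []
      ring
    · have hprod := hg.mul_prod huint
      refine (hprod.bdd_mul (f := fun q : ℝ × ℝ => Complex.exp (Complex.I * q.1 * q.2)) (c := 1)
        (Continuous.aestronglyMeasurable (by fun_prop))
        (Eventually.of_forall fun q => (norm_exp_I_mul_mul _ _).le)).congr
        (Eventually.of_forall fun q => ?_)
      simp only [Function.uncurry]
      ring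
  exact congrFun ((hf.ae_eq_iff_eq volume hFc).mp hae) x

/-! ### Decay and tail integrals -/

/-- A pure power of `1 + |t|` multiplies directly with the bound for `phi`; the price is `(1 + |t|)
^ η ≤ 2 ^ η (1 + |t| ^ η)`. -/
theorem FourierDecay.exists_le_one_add_abs_rpow {η : ℝ} (hη : 0 ≤ η) {g : ℝ → ℂ}
    (h : FourierDecay η g) : ∃ c : ℝ, 0 ≤ c ∧ ∀ t, ‖g t‖ ≤ c * (1 + |t|) ^ (-η) := by
  obtain ⟨C, hC, hb⟩ := h
  refine ⟨C * 2 ^ η, by positivity, fun t => (hb t).trans ?_⟩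
  have ht := abs_nonneg t
  have key : (1 + |t|) ^ η ≤ 2 ^ η * (1 + |t| ^ η) := by
    rcases le_total |t| 1 with h1 | h1
    · have h2 : (1 + |t|) ^ η ≤ 2 ^ η := Real.rpow_le_rpow (by positivity) (by linarith) hη
      have h3 : 0 ≤ |t| ^ η := by positivity
      have h4 : (0 : ℝ) < 2 ^ η := by positivity
      nlinarith
    · have h2 : (1 + |t|) ^ η ≤ (2 * |t|) ^ η :=
        Real.rpow_le_rpow (by positivity) (by linarith) hη
      rw [Real.mul_rpow (by norm_num) ht] at h2
      have h4 : (0 : ℝ) < 2 ^ η := by positivity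
      linarith
  rw [Real.rpow_neg (by positivity), ← div_eq_mul_inv, div_le_div_iff₀ (by positivity)
    (by positivity), mul_assoc]
  exact mul_le_mul_of_nonneg_left key hC.le

theorem integrable_one_add_abs_rpow_neg {r : ℝ} (hr : 1 < r) :
    Integrable fun t : ℝ => (1 + |t|) ^ (-r) := by
  have := integrable_one_add_norm (E := ℝ) (μ := volume) (r := r) (by simpa using hr)
  simpa only [Real.norm_eq_abs] using this

theorem setIntegral_compl_one_add_abs_rpow_neg_le {r R : ℝ} (hr : 1 < r) (hR : 0 < R) :
    ∫ t in {t : ℝ | |t| ≤ R}ᶜ, (1 + |t|) ^ (-r) ≤ 2 / (r - 1) / R ^ (r - 1) := by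
  have hms : MeasurableSet {t : ℝ | |t| ≤ R} := measurableSet_le (by fun_prop) (by fun_prop)
  have heq : ∫ t in {t : ℝ | |t| ≤ R}ᶜ, (1 + |t|) ^ (-r)
      = ∫ t : ℝ, (Set.Ioi R).indicator (fun x : ℝ => (1 + x) ^ (-r)) |t| := by
    rw [← integral_indicator hms.compl]
    congr 1
    ext t
    by_cases ht : |t| ≤ R
    · rw [Set.indicator_of_notMem (by simpa using ht), Set.indicator_of_notMem (by simpa using ht)]
    · rw [Set.indicator_of_mem (by simpa using ht), Set.indicator_of_mem (by simpa using ht)]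
  rw [heq, integral_comp_abs, setIntegral_indicator measurableSet_Ioi, Set.Ioi_inter_Ioi,
    max_eq_right hR.le]
  have hpow := integral_Ioi_rpow_of_lt (a := -r) (by linarith) hR
  have hle : ∫ x in Set.Ioi R, (1 + x) ^ (-r) ≤ ∫ x in Set.Ioi R, x ^ (-r) := by
    refine setIntegral_mono_on ?_ (integrableOn_Ioi_rpow_of_lt (by linarith) hR)
      measurableSet_Ioi fun x hx => ?_
    · refine ((integrable_one_add_abs_rpow_neg hr).integrableOn (s := Set.Ioi R)).congr_fun
        (fun x hx => ?_) measurableSet_Ioi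
      simp only
      rw [abs_of_pos (hR.trans hx)]
    · have hx0 : 0 < x := hR.trans hx
      exact Real.rpow_le_rpow_of_nonpos hx0 (by linarith) (by linarith)
  have hval : -R ^ (-r + 1) / (-r + 1) = 1 / (r - 1) / R ^ (r - 1) := by
    rw [show -r + 1 = -(r - 1) by ring, Real.rpow_neg hR.le, neg_div_neg_eq]
    have : r - 1 ≠ 0 := by linarith
    field_simp
  calc _ ≤ 2 * (1 / (r - 1) / R ^ (r - 1)) := by rw [← hval, ← hpow]; linarith
    _ = _ := by ring

/-! ### Absorbing an unbounded relative error -/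

/-- The pointwise estimate for the main range: a relative error of size `u log L / L`, not
necessarily bounded, is integrable against `u ^ (-σ)` with an admissible total. -/
theorem rpow_neg_mul_error_le {a σ A : ℝ} (ha : 0 < a) (hA : 0 ≤ A) :
    ∃ K : ℝ, 0 ≤ K ∧ ∀ᶠ L : ℝ in atTop, ∀ u : ℝ, 1 ≤ u → u ≤ 2 * L →
      A * (u * (Real.log L / L)) ≤ a / 4 * Real.log L →
      u ^ (-σ) * (A * (u * (Real.log L / L)) * Real.exp (A * (u * (Real.log L / L))))
        ≤ K * (Real.log L / L + L ^ (a + 1 - σ)) * u ^ (-(1 + a / 4)) := by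
  set δ := a / 4 with hδ
  have hδ0 : 0 < δ := by positivity
  -- One summand for each of the three cases below.
  refine ⟨A * 2 ^ (2 + δ - σ) / δ + A * Real.exp A + A, by positivity, ?_⟩
  have hlittle := (isLittleO_log_rpow_rpow_atTop (σ - 1 - δ) hδ0).bound one_pos
  filter_upwards [hlittle, eventually_ge_atTop (Real.exp 1)] with L hlit hL u hu1 hu2 hexp
  have hL1 : 1 ≤ L := le_trans (by linarith [Real.add_one_le_exp (1 : ℝ)]) hL
  have hL0 : 0 < L := by linarith
  have hlog : 1 ≤ Real.log L := (Real.le_log_iff_exp_le hL0).mpr hL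
  have hu0 : 0 < u := by linarith
  set q := Real.log L / L with hq
  have hq0 : 0 < q := by positivity
  have hE : Real.exp (A * (u * q)) ≤ L ^ δ := by
    rw [Real.rpow_def_of_pos hL0, mul_comm (Real.log L)]
    exact Real.exp_le_exp.mpr hexp
  have hup : 0 < u ^ (-(1 + δ)) := by positivity
  have hLp : 0 < L ^ (a + 1 - σ) := by positivity
  have hexpo : L ^ (1 + 3 * δ - σ) ≤ L ^ (a + 1 - σ) :=
    Real.rpow_le_rpow_of_exponent_le hL1 (by rw [hδ]; linarith)
  have hK1 : 0 ≤ A * 2 ^ (2 + δ - σ) / δ := by positivity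
  have hK2 : 0 ≤ A * Real.exp A := by positivity
  -- For small `σ` the excess power of `u` is traded for a power of `2 L`. The total exponent of `L`
  -- is `1 + 3 δ - σ`, below `a + 1 - σ` because `a = 4 δ`.
  rcases le_total σ (2 + δ) with hs | hs
  · have e1 : u ^ (-σ) * u = u ^ (-(1 + δ)) * u ^ (2 + δ - σ) := by
      rw [← Real.rpow_add_one hu0.ne', ← Real.rpow_add hu0]
      congr 1
      ring
    have e2 : u ^ (2 + δ - σ) ≤ 2 ^ (2 + δ - σ) * L ^ (2 + δ - σ) := by
      rw [← Real.mul_rpow (by norm_num) hL0.le]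
      exact Real.rpow_le_rpow hu0.le hu2 (by linarith)
    have e3 : q ≤ L ^ δ / δ * L ^ (-1 : ℝ) := by
      rw [hq, div_eq_mul_inv, Real.rpow_neg_one]
      exact mul_le_mul_of_nonneg_right (Real.log_le_rpow_div hL0.le hδ0) (by positivity)
    have e4 : L ^ δ * L ^ (-1 : ℝ) * L ^ δ * L ^ (2 + δ - σ) = L ^ (1 + 3 * δ - σ) := by
      rw [← Real.rpow_add hL0, ← Real.rpow_add hL0, ← Real.rpow_add hL0]
      congr 1
      ring
    calc u ^ (-σ) * (A * (u * q) * Real.exp (A * (u * q)))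
        = A * (u ^ (-σ) * u) * q * Real.exp (A * (u * q)) := by ring
      _ ≤ A * (u ^ (-(1 + δ)) * (2 ^ (2 + δ - σ) * L ^ (2 + δ - σ)))
            * (L ^ δ / δ * L ^ (-1 : ℝ)) * L ^ δ := by
          rw [e1]
          gcongr
      _ = A * 2 ^ (2 + δ - σ) / δ * (L ^ δ * L ^ (-1 : ℝ) * L ^ δ * L ^ (2 + δ - σ))
            * u ^ (-(1 + δ)) := by ring
      _ ≤ _ := by
          rw [e4]
          refine mul_le_mul_of_nonneg_right ?_ hup.le
          exact mul_le_mul (by linarith) (by linarith) (by positivity) (by positivity)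
  · rcases le_total (u * q) 1 with huq | huq
    · have e1 : u ^ (-σ) * u ≤ u ^ (-(1 + δ)) := by
        rw [← Real.rpow_add_one hu0.ne']
        exact Real.rpow_le_rpow_of_exponent_le hu1 (by linarith)
      have e2 : Real.exp (A * (u * q)) ≤ Real.exp A :=
        Real.exp_le_exp.mpr (mul_le_of_le_one_right hA huq)
      calc u ^ (-σ) * (A * (u * q) * Real.exp (A * (u * q)))
          = A * (u ^ (-σ) * u) * q * Real.exp (A * (u * q)) := by ring
        _ ≤ A * u ^ (-(1 + δ)) * q * Real.exp A := by gcongr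
        _ = A * Real.exp A * q * u ^ (-(1 + δ)) := by ring
        _ ≤ _ := by
            refine mul_le_mul_of_nonneg_right ?_ hup.le
            exact mul_le_mul (by linarith) (by linarith) hq0.le (by positivity)
    -- As `u q ≥ 1` and `m ≥ 1`, the factor `u q` may be raised to the power `m`, chosen so that
    -- exactly `u ^ (-(1 + δ))` remains.
    · set m := σ - 1 - δ with hm
      have e1 : u * q ≤ (u * q) ^ m := by
        conv_lhs => rw [← Real.rpow_one (u * q)]
        exact Real.rpow_le_rpow_of_exponent_le huq (by rw [hm]; linarith)
      have e2 : u ^ (-σ) * (u * q) ^ m = u ^ (-(1 + δ)) * q ^ m := by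
        rw [Real.mul_rpow hu0.le hq0.le, ← mul_assoc, ← Real.rpow_add hu0]
        congr 2
        rw [hm]
        ring
      have e3 : q ^ m ≤ L ^ δ * L ^ (-m) := by
        rw [hq, Real.div_rpow (by linarith) hL0.le, Real.rpow_neg hL0.le, ← div_eq_mul_inv]
        refine div_le_div_of_nonneg_right ?_ (by positivity)
        rw [one_mul, Real.norm_of_nonneg (by positivity), Real.norm_of_nonneg (by positivity)]
          at hlit
        exact hlit
      have e4 : L ^ δ * L ^ (-m) * L ^ δ = L ^ (1 + 3 * δ - σ) := by
        rw [← Real.rpow_add hL0, ← Real.rpow_add hL0]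
        congr 1
        rw [hm]
        ring
      calc u ^ (-σ) * (A * (u * q) * Real.exp (A * (u * q)))
          ≤ u ^ (-σ) * (A * (u * q) ^ m * L ^ δ) := by gcongr
        _ = A * (u ^ (-σ) * (u * q) ^ m) * L ^ δ := by ring
        _ ≤ A * (u ^ (-(1 + δ)) * (L ^ δ * L ^ (-m))) * L ^ δ := by
            rw [e2]
            gcongr
        _ = A * (L ^ δ * L ^ (-m) * L ^ δ) * u ^ (-(1 + δ)) := by ring
        _ ≤ _ := by
            rw [e4]
            refine mul_le_mul_of_nonneg_right ?_ hup.le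
            exact mul_le_mul (by linarith) (by linarith) (by positivity) (by positivity)

/-! ### Assembling the main theorem -/

theorem continuous_twistedSmoothSum (k : ℕ) (α : ℂ) (N : ℕ) :
    Continuous (twistedSmoothSum k α N) := by
  unfold twistedSmoothSum
  fun_prop

theorem integrable_mul_twistedSmoothSum {g : ℝ → ℂ} (hg : Integrable g) (k : ℕ) (α : ℂ) (N : ℕ)
    (L : ℝ) : Integrable fun t => g t * twistedSmoothSum k α N (t / L) := by
  refine hg.mul_bdd (c := ∑ n ∈ (kFreeSmooth_finite k N).toFinset,
    ‖α ^ ArithmeticFunction.cardFactors n / (n : ℂ)‖)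
    ((continuous_twistedSmoothSum k α N).comp (by fun_prop)).aestronglyMeasurable
    (Eventually.of_forall fun t => ?_)
  refine norm_sum_le_of_le _ fun n _ => ?_
  rw [norm_mul, norm_exp_I_mul_mul, mul_one]

theorem smoothSum_eq_integral {f g : ℝ → ℂ} (h : IsFourierTransform f g) (hf : Continuous f)
    (hg : Integrable g) (k : ℕ) (α : ℂ) (N : ℕ) :
    smoothSum f k α N = ∫ t : ℝ, g t * twistedSmoothSum k α N (t / Real.log N) := by
  have hint : ∀ n : ℕ, Integrable fun t : ℝ => g t * (α ^ ArithmeticFunction.cardFactors n / (n : ℂ)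
      * Complex.exp (Complex.I * (t / Real.log N : ℝ) * (Real.log n : ℝ))) := fun n => by
    refine hg.mul_bdd (c := ‖α ^ ArithmeticFunction.cardFactors n / (n : ℂ)‖)
      (Continuous.aestronglyMeasurable (by fun_prop)) (Eventually.of_forall fun t => ?_)
    rw [norm_mul, norm_exp_I_mul_mul, mul_one]
  unfold smoothSum twistedSmoothSum
  simp only [Finset.mul_sum]
  rw [integral_finsetSum _ fun n _ => hint n]
  refine Finset.sum_congr rfl fun n _ => ?_
  rw [h.eq_integral hf hg, ← integral_mul_const]
  refine integral_congr_ae (Eventually.of_forall fun t => ?_)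
  have : Complex.I * t * ((Real.log n / Real.log N : ℝ) : ℂ)
      = Complex.I * (t / Real.log N : ℝ) * (Real.log n : ℝ) := by
    push_cast
    ring
  simp only [this]
  ring

theorem norm_exp_sub_one_le_mul_exp (z : ℂ) : ‖Complex.exp z - 1‖ ≤ ‖z‖ * Real.exp ‖z‖ := by
  simpa using Complex.norm_exp_sub_sum_le_norm_mul_exp z 1

theorem theorem1 (k : ℕ) (hk : 2 ≤ k) (α : ℂ) (hα0 : α ≠ 0) (hα : ‖α‖ < 2) :
    ∃ C : ℂ, C ≠ 0 ∧
      ∀ (η : ℝ), ‖α‖ - α.re + 1 < η →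
      ∀ (f fhat : ℝ → ℂ), Continuous f → (∃ M : ℝ, ∀ x : ℝ, ‖f x‖ ≤ M) →
        IsFourierTransform f fhat → FourierDecay η fhat →
      ∀ (R : ℕ → ℝ), (∀ᶠ N in atTop, 0 < R N) →
        Tendsto (fun N : ℕ => R N / Real.log N) atTop (𝓝 0) →
        Tendsto (fun N : ℕ => Real.log N ^ (‖α‖ - α.re) / R N ^ (η - 1)) atTop (𝓝 0) →
      ∃ ε : ℕ → ℂ,
        (∀ N : ℕ, 2 ≤ N →
          smoothSum f k α N =
            C * (Real.log N : ℂ) ^ α *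
              ((∫ t in {t : ℝ | |t| ≤ R N}, phi α t * fhat t) + ε N)) ∧
        Tendsto ε atTop (𝓝 0) ∧
        ε =O[atTop] (fun N : ℕ =>
          Real.log (Real.log N) / Real.log N
            + Real.log N ^ (‖α‖ - α.re) / R N ^ (η - 1)) := by
  obtain ⟨C, A, hC, hA, hasymp⟩ := twistedSmoothSum_asymptotic hk hα
  obtain ⟨K₁, hK₁, htriv⟩ := norm_twistedSmoothSum_le hk hα
  obtain ⟨K₂, hK₂, hphi⟩ := norm_phi_le α
  refine ⟨C, hC, fun η hη f fhat hf _ hfour hdecay R hRpos hRlog hRη => ?_⟩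
  have ha : 0 < ‖α‖ := norm_pos_iff.mpr hα0
  have hre : α.re ≤ ‖α‖ := Complex.re_le_norm α
  have hη1 : 1 < η := by linarith
  obtain ⟨c, hc, hfb⟩ := hdecay.exists_le_one_add_abs_rpow (by linarith)
  have hfint : Integrable fhat :=
    ((integrable_one_add_abs_rpow_neg hη1).const_mul c).mono' hfour.1 (Eventually.of_forall hfb)
  have hσ : ‖α‖ + 1 < α.re + η := by linarith
  have hprodb : ∀ t, ‖phi α t * fhat t‖ ≤ K₂ * c * (1 + |t|) ^ (-(α.re + η)) := fun t => by
    have hpos : 0 < 1 + |t| := by positivity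
    rw [norm_mul]
    calc _ ≤ (K₂ * (1 + |t|) ^ (-α.re)) * (c * (1 + |t|) ^ (-η)) :=
          mul_le_mul (hphi t) (hfb t) (norm_nonneg _) (by positivity)
      _ = K₂ * c * ((1 + |t|) ^ (-α.re) * (1 + |t|) ^ (-η)) := by ring
      _ = _ := by
          rw [← Real.rpow_add hpos]
          congr 2
          ring
  have hprodint : Integrable fun t => phi α t * fhat t :=
    ((integrable_one_add_abs_rpow_neg (by linarith)).const_mul (K₂ * c)).mono'
      ((continuous_phi α).aestronglyMeasurable.mul hfour.1) (Eventually.of_forall hprodb)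
  -- The error is defined by solving the claimed identity, which then holds for every `N ≥ 2`; only
  -- its size is at stake.
  set ε : ℕ → ℂ := fun N => smoothSum f k α N / (C * (Real.log N : ℂ) ^ α)
    - ∫ t in {t : ℝ | |t| ≤ R N}, phi α t * fhat t with hε
  set T : ℕ → ℝ := fun N => Real.log N ^ (‖α‖ - α.re) / R N ^ (η - 1) with hT
  obtain ⟨K₃, hK₃, hpt⟩ := rpow_neg_mul_error_le (σ := α.re + η) ha hA
  set J := ∫ t : ℝ, (1 + |t|) ^ (-(1 + ‖α‖ / 4)) with hJ
  have hlogtend : Tendsto (fun N : ℕ => Real.log N) atTop atTop :=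
    Real.tendsto_log_atTop.comp tendsto_natCast_atTop_atTop
  have hO : ε =O[atTop] (fun N : ℕ => Real.log (Real.log N) / Real.log N + T N) := by
    refine IsBigO.of_bound (K₂ * c * K₃ * J + K₁ / ‖C‖ * c * (2 / (η - 1))) ?_
    -- Since `R / L → 0`, the exponent error is at most `(|α| / 4) log L` on `|t| ≤ R`, as
    -- `rpow_neg_mul_error_le` requires.
    have hsmall : ∀ᶠ N : ℕ in atTop, A * ((1 + R N) / Real.log N) ≤ ‖α‖ / 4 := by
      have h1 : Tendsto (fun N : ℕ => A * (1 / Real.log N + R N / Real.log N)) atTop (𝓝 0) := by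
        simpa using ((hlogtend.const_div_atTop 1).add hRlog).const_mul A
      filter_upwards [h1.eventually (ge_mem_nhds (show 0 < ‖α‖ / 4 by positivity))] with N hN
      rwa [add_div]
    have hRle : ∀ᶠ N : ℕ in atTop, R N / Real.log N ≤ 1 :=
      hRlog.eventually (ge_mem_nhds one_pos)
    filter_upwards [hasymp, htriv, hRpos, hsmall, hRle, hlogtend.eventually hpt,
      hlogtend.eventually_ge_atTop 1] with N hasymp htriv hR0 hsmall hRle hpt hL1
    set L := Real.log N with hL
    have hL0 : 0 < L := by linarith
    have hLL : 0 ≤ Real.log L := Real.log_nonneg hL1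
    rw [div_le_one hL0] at hRle
    have hLC : (L : ℂ) ^ α ≠ 0 := by
      rw [Complex.cpow_def_of_ne_zero (by exact_mod_cast hL0.ne')]
      exact Complex.exp_ne_zero _
    set D := C * (L : ℂ) ^ α with hD
    have hD0 : D ≠ 0 := mul_ne_zero hC hLC
    have hnD : ‖D‖ = ‖C‖ * L ^ α.re := by
      rw [hD, norm_mul, Complex.norm_cpow_eq_rpow_re_of_pos hL0]
    set S : Set ℝ := {t : ℝ | |t| ≤ R N} with hS
    have hSm : MeasurableSet S := measurableSet_le (by fun_prop) (by fun_prop)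
    have hZint : Integrable fun t => fhat t * twistedSmoothSum k α N (t / L) :=
      integrable_mul_twistedSmoothSum hfint k α N L
    have hεN : ε N = (∫ t in S, (fhat t * twistedSmoothSum k α N (t / L) / D
        - phi α t * fhat t))
        + ∫ t in Sᶜ, fhat t * twistedSmoothSum k α N (t / L) / D := by
      rw [integral_sub (hZint.div_const D).integrableOn hprodint.integrableOn, sub_add_eq_add_sub,
        integral_add_compl hSm (hZint.div_const D), integral_div]
      simp only [hε]
      rw [smoothSum_eq_integral hfour hf hfint]
    have hT0 : 0 ≤ T N := by simp only [hT]; positivity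
    have hq0 : 0 ≤ Real.log L / L := by positivity
    -- The left side is `T N` with `R` replaced by `L`, and `R ≤ L`.
    have hLT : L ^ (‖α‖ + 1 - (α.re + η)) ≤ T N := by
      have h1 : L ^ (‖α‖ + 1 - (α.re + η)) = L ^ (‖α‖ - α.re) / L ^ (η - 1) := by
        rw [← Real.rpow_sub hL0]
        congr 1
        ring
      rw [h1]
      exact div_le_div_of_nonneg_left (by positivity) (by positivity)
        (Real.rpow_le_rpow hR0.le hRle (by linarith))
    have hmain : ‖∫ t in S, (fhat t * twistedSmoothSum k α N (t / L) / D - phi α t * fhat t)‖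
        ≤ K₂ * c * K₃ * J * (Real.log L / L + T N) := by
      set B := K₂ * c * (K₃ * (Real.log L / L + T N)) with hB
      have hB0 : 0 ≤ B := by positivity
      have hJint := integrable_one_add_abs_rpow_neg (r := 1 + ‖α‖ / 4) (by linarith)
      calc _ ≤ ∫ t in S, B * (1 + |t|) ^ (-(1 + ‖α‖ / 4)) := by
            refine norm_integral_le_of_norm_le (hJint.const_mul B).integrableOn
              ((ae_restrict_iff' hSm).mpr (Eventually.of_forall fun t ht => ?_))
            have ht : |t| ≤ R N := ht
            have ht0 := abs_nonneg t
            obtain ⟨z, hz, hval⟩ := hasymp t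
            have heq : fhat t * twistedSmoothSum k α N (t / L) / D - phi α t * fhat t
                = phi α t * fhat t * (Complex.exp z - 1) := by
              rw [hval]
              field_simp
            have hz' : ‖Complex.exp z - 1‖ ≤ A * ((1 + |t|) * (Real.log L / L))
                * Real.exp (A * ((1 + |t|) * (Real.log L / L))) :=
              (norm_exp_sub_one_le_mul_exp z).trans
                (mul_le_mul hz (Real.exp_le_exp.mpr hz) (Real.exp_pos _).le (by positivity))
            have hsm : A * ((1 + |t|) * (Real.log L / L)) ≤ ‖α‖ / 4 * Real.log L := by
              calc _ = A * ((1 + |t|) / L) * Real.log L := by ring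
                _ ≤ A * ((1 + R N) / L) * Real.log L := by gcongr
                _ ≤ _ := mul_le_mul_of_nonneg_right hsmall hLL
            have h5 := hpt (1 + |t|) (by linarith) (by linarith) hsm
            rw [heq, norm_mul]
            calc _ ≤ (K₂ * c * (1 + |t|) ^ (-(α.re + η)))
                  * (A * ((1 + |t|) * (Real.log L / L))
                    * Real.exp (A * ((1 + |t|) * (Real.log L / L)))) :=
                  mul_le_mul (hprodb t) hz' (norm_nonneg _) (by positivity)
              _ = K₂ * c * ((1 + |t|) ^ (-(α.re + η)) * (A * ((1 + |t|) * (Real.log L / L))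
                    * Real.exp (A * ((1 + |t|) * (Real.log L / L))))) := by ring
              _ ≤ K₂ * c * (K₃ * (Real.log L / L + L ^ (‖α‖ + 1 - (α.re + η)))
                    * (1 + |t|) ^ (-(1 + ‖α‖ / 4))) := by gcongr
              _ ≤ K₂ * c * (K₃ * (Real.log L / L + T N)
                    * (1 + |t|) ^ (-(1 + ‖α‖ / 4))) := by gcongr
              _ = _ := by rw [hB]; ring
        _ ≤ ∫ t : ℝ, B * (1 + |t|) ^ (-(1 + ‖α‖ / 4)) :=
            setIntegral_le_integral (hJint.const_mul B)
              (Eventually.of_forall fun t => by positivity)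
        _ = _ := by rw [integral_const_mul, hB]; ring
    -- Cancellation in the twisted sum is ignored here: `L ^ |α|` against `|L ^ α| = L ^ (Re α)`
    -- produces the numerator of `T`, and the tail of `fhat` its denominator.
    have htail : ‖∫ t in Sᶜ, fhat t * twistedSmoothSum k α N (t / L) / D‖
        ≤ K₁ / ‖C‖ * c * (2 / (η - 1)) * T N := by
      set B := K₁ / ‖C‖ * c * L ^ (‖α‖ - α.re) with hB
      have hηint := integrable_one_add_abs_rpow_neg hη1
      have hnC : 0 < ‖C‖ := norm_pos_iff.mpr hC
      have hB0 : 0 ≤ B := by positivity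
      calc _ ≤ ∫ t in Sᶜ, B * (1 + |t|) ^ (-η) := by
            refine norm_integral_le_of_norm_le (hηint.const_mul B).integrableOn
              (Eventually.of_forall fun t => ?_)
            rw [norm_div, norm_mul, hnD]
            calc _ ≤ (c * (1 + |t|) ^ (-η)) * (K₁ * L ^ ‖α‖) / (‖C‖ * L ^ α.re) := by
                  refine div_le_div_of_nonneg_right ?_ (by positivity)
                  exact mul_le_mul (hfb t) (htriv _) (norm_nonneg _) (by positivity)
              _ = _ := by
                  rw [hB, Real.rpow_sub hL0]
                  ring
        _ = B * ∫ t in Sᶜ, (1 + |t|) ^ (-η) := integral_const_mul _ _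
        _ ≤ B * (2 / (η - 1) / R N ^ (η - 1)) :=
            mul_le_mul_of_nonneg_left (setIntegral_compl_one_add_abs_rpow_neg_le hη1 hR0) hB0
        _ = _ := by
            simp only [hB, hT]
            ring
    rw [Real.norm_of_nonneg (add_nonneg hq0 hT0), hεN]
    refine (norm_add_le _ _).trans ((add_le_add hmain htail).trans ?_)
    have h6 : 0 ≤ K₁ / ‖C‖ * c * (2 / (η - 1)) := by
      have : 0 < η - 1 := by linarith
      positivity
    have h7 := mul_nonneg h6 hq0
    linarith
  refine ⟨ε, fun N hN => ?_, ?_, hO⟩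
  · have hL0 : 0 < Real.log N := Real.log_pos (by exact_mod_cast hN)
    have hLC : (Real.log N : ℂ) ^ α ≠ 0 := by
      rw [Complex.cpow_def_of_ne_zero (by exact_mod_cast hL0.ne')]
      exact Complex.exp_ne_zero _
    simp only [hε]
    rw [add_sub_cancel, mul_div_cancel₀ _ (mul_ne_zero hC hLC)]
  · refine hO.trans_tendsto ?_
    have h1 : Tendsto (fun x : ℝ => Real.log x / x) atTop (𝓝 0) :=
      Real.isLittleO_log_id_atTop.tendsto_div_nhds_zero
    simpa using (h1.comp hlogtend).add hRη
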